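/- Let $M$ be a connected smooth $2$-dimensional manifold, with induced coordinates $(x^i,y^i)$ on $TM$, and let $T_0M$ be $TM$ without the zero section. Let $F:TM\to\mathbb R$ be a Finsler function: $F$ is continuous, smooth and strictly positive on $T_0M$, satisfies $F(x,\lambda y)=\lambda F(x,y)$ for $\lambda>0$, and the matrix $g_{ij}=\frac12\,\partial^2F^2/\partial y^i\partial y^j$ has rank $2$ on $T_0M$. Put $J=dx^i\otimes\partial/\partial y^i$, $\mathcal C=y^i\,\partial/\partial y^i$ and $d_Jf=\frac{\partial f}{\partial y^i}dx^i$. Let $S$ be the geodesic spray of $F$, the unique vector field on $T_0M$ with $i_S\,dd_JF^2=-dF^2$. With Frölicher–Nijenhuis brackets, let $h=\frac12(\mathrm{Id}-[S,J])$ and $v=\frac12(\mathrm{Id}+[S,J])$ be its horizontal and vertical projectors, $\Phi=v\circ[S,h]=R^i_j\,\frac{\partial}{\partial y^i}\otimes dx^j$ its Jacobi endomorphism, $\operatorname{Tr}\Phi=R^i_i$, $\rho=\frac1{n-1}\operatorname{Tr}\Phi$ with $n=\dim M=2$, and $R=\frac12[h,h]$ its curvature tensor, so that $\Phi=i_SR$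 and $3R=[J,\Phi]$. Put $$W_1=R-\frac{1}{2(n-1)}\,d_J(\operatorname{Tr}\Phi)\wedge J=R-\frac12\,d_J(\operatorname{Tr}\Phi)\wedge J,$$ where $(\omega\wedge J)(X,Y)=\omega(X)JY-\omega(Y)JX$. $F$ has constant flag curvature if there is a constant $\kappa\in\mathbb R$ with $\Phi=\kappa F^2J-\kappa F\,d_JF\otimes\mathcal C$ on $T_0M$. Then there is a smooth semi-basic $1$-form $\alpha=\alpha_i(x,y)\,dx^i$ on $T_0M$ with $\Phi=\rho J-\alpha\otimes\mathcal C$, and for any such $\alpha$ the following are equivalent: (a) $F$ has constant flag curvature; (b) $W_1=0$ and $d_h\alpha=0$ on $T_0M$, where $d_h=i_h\circ d-d\circ i_h$. -/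

import Mathlib

open Set Bundle
open scoped Manifold ContDiff

noncomputable section

namespace Finsler

/-! ## Calculus on the tangent bundle in induced coordinates

In a chart with values in `E`, a point or a tangent vector of the tangent bundle is an element of
`E × E`: a point is `z = (x, y)`, and `(u, w)` stands for `uⁱ ∂/∂xⁱ + wⁱ ∂/∂yⁱ`.  A vector field is
a map `E × E → E × E`, a 1-form a map `E × E → (E × E →L[ℝ] ℝ)`, a vector-valued 1-form a map
`E × E → (E × E →L[ℝ] E × E)`. -/

section Coordinates

variable {E : Type*} [NormedAddCommGroup E] [NormedSpace ℝ E]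

/-- The tangent endomorphism `J = dxⁱ ⊗ ∂/∂yⁱ`. -/
def J : E × E →L[ℝ] E × E :=
  (ContinuousLinearMap.inr ℝ E E).comp (ContinuousLinearMap.fst ℝ E E)

/-- The Liouville vector field `C = yⁱ ∂/∂yⁱ`. -/
def liouville (z : E × E) : E × E := (0, z.2)

/-- The exterior derivative of a 1-form: `(dθ)(ξ, η) = ξ(θ(η)) - η(θ(ξ)) - θ([ξ, η])`, evaluated on
constant vector fields `ξ`, `η`. -/
def extD (θ : E × E → E × E →L[ℝ] ℝ) (z : E × E) : E × E →L[ℝ] E × E →L[ℝ] ℝ :=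
  fderiv ℝ θ z - (fderiv ℝ θ z).flip

/-- `d_J f = df ∘ J` for a function `f`. -/
def dJ (f : E × E → ℝ) (z : E × E) : E × E →L[ℝ] ℝ := (fderiv ℝ f z).comp J

/-- The derivation `d_K = i_K ∘ d - d ∘ i_K` of a vector-valued 1-form `K`, applied to a 1-form `α`:
`(d_K α)(ξ, η) = dα(Kξ, η) + dα(ξ, Kη) - d(α ∘ K)(ξ, η)`. -/
def dForm (K : E × E → E × E →L[ℝ] E × E) (α : E × E → E × E →L[ℝ] ℝ) (z ξ η : E × E) : ℝ :=
  extD α z (K z ξ) η + extD α z ξ (K z η) - extD (fun z' => (α z').comp (K z')) z ξ η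

/-- The Frölicher–Nijenhuis bracket `[X, K]` of a vector field and a vector-valued 1-form, which is
the Lie derivative `[X, K](ξ) = [X, Kξ] - K[X, ξ]`. On a constant vector field `ξ` this is
`DK(X) ξ - DX(Kξ) + K(DX(ξ))`. -/
def lieD (X : E × E → E × E) (K : E × E → E × E →L[ℝ] E × E) (z : E × E) : E × E →L[ℝ] E × E :=
  fderiv ℝ K z (X z) - (fderiv ℝ X z).comp (K z) + (K z).comp (fderiv ℝ X z)

/-- Half of the Frölicher–Nijenhuis bracket of a vector-valued 1-form with itself:
`½[K, K](ξ, η) = [Kξ, Kη] - K[Kξ, η] - K[ξ, Kη] + K²[ξ, η]`, evaluated on constant vector fields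
`ξ`, `η` (the last term then vanishes). -/
def halfBracket (K : E × E → E × E →L[ℝ] E × E) (z ξ η : E × E) : E × E :=
  VectorField.lieBracket ℝ (fun z' => K z' ξ) (fun z' => K z' η) z
    - K z (VectorField.lieBracket ℝ (fun z' => K z' ξ) (fun _ => η) z)
    - K z (VectorField.lieBracket ℝ (fun _ => ξ) (fun z' => K z' η) z)

/-- `(θ ∧ J)(ξ, η) = θ(ξ) Jη - θ(η) Jξ` for a covector `θ`. -/
def wedgeJ (θ : E × E →L[ℝ] ℝ) (ξ η : E × E) : E × E := θ ξ • J η - θ η • J ξ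

/-- The geodesic spray: the solution `S` of `i_S d d_J F² = -dF²`. Where the 2-form `d d_J F²` is
nondegenerate, it is the only solution. -/
def geodesicSpray (F : E × E → ℝ) (z : E × E) : E × E :=
  (extD (dJ fun z' => F z' ^ 2) z).inverse (-fderiv ℝ (fun z' => F z' ^ 2) z)

/-- The horizontal projector `h = ½(Id - [S, J])`. -/
def horizontal (S : E × E → E × E) (z : E × E) : E × E →L[ℝ] E × E :=
  (1 / 2 : ℝ) • (ContinuousLinearMap.id ℝ (E × E) - lieD S (fun _ => J) z)

/-- The vertical projector `v = ½(Id + [S, J])`. -/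
def vertical (S : E × E → E × E) (z : E × E) : E × E →L[ℝ] E × E :=
  (1 / 2 : ℝ) • (ContinuousLinearMap.id ℝ (E × E) + lieD S (fun _ => J) z)

/-- The Jacobi endomorphism `Φ = v ∘ [S, h] = Rⁱⱼ ∂/∂yⁱ ⊗ dxʲ`. -/
def jacobi (S : E × E → E × E) (z : E × E) : E × E →L[ℝ] E × E :=
  (vertical S z).comp (lieD S (horizontal S) z)

/-- `Tr Φ = Rⁱᵢ`, the trace of the endomorphism `(Rⁱⱼ)` of `E`. (As an endomorphism of the
tangent spaces of the tangent bundle, `Φ` is nilpotent.) -/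
def trJacobi (S : E × E → E × E) (z : E × E) : ℝ :=
  LinearMap.trace ℝ E
    (((ContinuousLinearMap.snd ℝ E E).comp
      ((jacobi S z).comp (ContinuousLinearMap.inl ℝ E E)) : E →L[ℝ] E) : E →ₗ[ℝ] E)

/-- The Ricci scalar `ρ = Tr Φ / (n - 1)`. -/
def ricci (S : E × E → E × E) (z : E × E) : ℝ :=
  1 / ((Module.finrank ℝ E : ℝ) - 1) * trJacobi S z

/-- The curvature tensor of the nonlinear connection, `R = ½[h, h]`, with the sign for which
`Φ = i_S R` and `3R = [J, Φ]`. -/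
def curvature (S : E × E → E × E) (z ξ η : E × E) : E × E := halfBracket (horizontal S) z ξ η

/-- The Weyl-type tensor `W₁ = R - 1/(2(n-1)) d_J(Tr Φ) ∧ J`. -/
def weylOne (S : E × E → E × E) (z ξ η : E × E) : E × E :=
  curvature S z ξ η
    - (1 / (2 * ((Module.finrank ℝ E : ℝ) - 1))) • wedgeJ (dJ (trJacobi S) z) ξ η

/-- The metric tensor `½ ∂²F²/∂yⁱ∂yʲ` at `z`, as a bilinear form in `u`, `w`. -/
def metric (F : E × E → ℝ) (z : E × E) (u w : E) : ℝ :=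
  1 / 2 * fderiv ℝ (fderiv ℝ fun y => F (z.1, y) ^ 2) z.2 u w

end Coordinates

/-! ## Finsler functions on a manifold -/

section Manifold

variable {E : Type*} [NormedAddCommGroup E] [NormedSpace ℝ E]
  {M : Type*} [TopologicalSpace M] [ChartedSpace E M]

/-- The coordinate domain of the slit tangent bundle `T₀M` induced by a chart `φ`. -/
def slit (φ : OpenPartialHomeomorph M E) : Set (E × E) := {z | z.1 ∈ φ.target ∧ z.2 ≠ 0}

/-- The inverse of the chart of the tangent bundle induced by `φ`:
`(x, y) ↦ yⁱ ∂/∂xⁱ`, a tangent vector at `φ⁻¹(x)`. -/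
def lift (φ : OpenPartialHomeomorph M E) (z : E × E) : TangentBundle 𝓘(ℝ, E) M :=
  ⟨φ.symm z.1, mfderiv 𝓘(ℝ, E) 𝓘(ℝ, E) φ.symm z.1 z.2⟩

/-- A function on the tangent bundle, read in the coordinates induced by `φ`. -/
def inChart (F : TangentBundle 𝓘(ℝ, E) M → ℝ) (φ : OpenPartialHomeomorph M E) : E × E → ℝ :=
  fun z => F (lift φ z)

/-- The geodesic spray of `F`, read in the coordinates induced by `φ`. -/
def spray (F : TangentBundle 𝓘(ℝ, E) M → ℝ) (φ : OpenPartialHomeomorph M E) : E × E → E × E :=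
  geodesicSpray (inChart F φ)

/-- A Finsler function: continuous on `TM`, smooth and positive on `T₀M`, positively homogeneous of
order 1, with a metric tensor of full rank on `T₀M`. -/
structure IsFinsler [IsManifold 𝓘(ℝ, E) ∞ M] (F : TangentBundle 𝓘(ℝ, E) M → ℝ) : Prop where
  continuous : Continuous F
  smooth : ContMDiffOn 𝓘(ℝ, E).tangent 𝓘(ℝ, ℝ) ∞ F {p | p.2 ≠ 0}
  pos : ∀ p : TangentBundle 𝓘(ℝ, E) M, p.2 ≠ 0 → 0 < F p
  homogeneous : ∀ (x : M) (y : TangentSpace 𝓘(ℝ, E) x) (c : ℝ), 0 < c →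
    F ⟨x, c • y⟩ = c * F ⟨x, y⟩
  nondegenerate : ∀ φ ∈ IsManifold.maximalAtlas 𝓘(ℝ, E) ∞ M, ∀ z ∈ slit φ, ∀ u : E,
    (∀ w : E, metric (inChart F φ) z u w = 0) → u = 0

/-- `F` has constant flag curvature: `Φ = κ F² J - κ F d_J F ⊗ C` on `T₀M` for a constant `κ`. -/
def HasConstantFlagCurvature (F : TangentBundle 𝓘(ℝ, E) M → ℝ) : Prop :=
  ∃ κ : ℝ, ∀ φ ∈ IsManifold.maximalAtlas 𝓘(ℝ, E) ∞ M, ∀ z ∈ slit φ,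
    jacobi (spray F φ) z = (κ * inChart F φ z ^ 2) • J
      - (κ * inChart F φ z) • (dJ (inChart F φ) z).smulRight (liouville z)

/-- The Weyl-type tensor `W₁` of the geodesic spray of `F` vanishes on `T₀M`. -/
def WeylOneVanishes (F : TangentBundle 𝓘(ℝ, E) M → ℝ) : Prop :=
  ∀ φ ∈ IsManifold.maximalAtlas 𝓘(ℝ, E) ∞ M, ∀ z ∈ slit φ, ∀ ξ η : E × E,
    weylOne (spray F φ) z ξ η = 0

variable (E M) in
/-- Semi-basic 1-forms `αᵢ(x, y) dxⁱ` on `T₀M`: such a form is a covector of `M` at `x` for each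
`(x, y)` (only the values with `y ≠ 0` are ever used). -/
abbrev SemiBasic : Type _ :=
  ∀ p : TangentBundle 𝓘(ℝ, E) M, TangentSpace 𝓘(ℝ, E) p.1 →L[ℝ] ℝ

/-- The 1-form `αᵢ(x, y) dxⁱ` in the coordinates induced by `φ`. -/
def localForm (α : SemiBasic E M) (φ : OpenPartialHomeomorph M E) (z : E × E) :
    E × E →L[ℝ] ℝ :=
  ((α (lift φ z)).comp (mfderiv 𝓘(ℝ, E) 𝓘(ℝ, E) φ.symm z.1)).comp (ContinuousLinearMap.fst ℝ E E)

/-- `α` is a smooth semi-basic 1-form on `T₀M` with `Φ = ρ J - α ⊗ C`, where `Φ` and `ρ` belong to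
the geodesic spray of `F`. -/
structure IsIsotropicForm (F : TangentBundle 𝓘(ℝ, E) M → ℝ) (α : SemiBasic E M) : Prop where
  smooth : ∀ φ ∈ IsManifold.maximalAtlas 𝓘(ℝ, E) ∞ M, ContDiffOn ℝ ∞ (localForm α φ) (slit φ)
  isotropic : ∀ φ ∈ IsManifold.maximalAtlas 𝓘(ℝ, E) ∞ M, ∀ z ∈ slit φ,
    jacobi (spray F φ) z = ricci (spray F φ) z • J - (localForm α φ z).smulRight (liouville z)

/-- `d_h α = 0` on `T₀M`, where `h` is the horizontal projector of the geodesic spray of `F`. -/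
def HorizontallyClosed (F : TangentBundle 𝓘(ℝ, E) M → ℝ) (α : SemiBasic E M) : Prop :=
  ∀ φ ∈ IsManifold.maximalAtlas 𝓘(ℝ, E) ∞ M, ∀ z ∈ slit φ, ∀ ξ η : E × E,
    dForm (horizontal (spray F φ)) (localForm α φ) z ξ η = 0

end Manifold

end Finsler

end

noncomputable section

namespace Finsler

open Filter Topology

/-! Put `L = F²` and let `S` be its spray, with connection `N`. Euler's identity and the
Euler–Lagrange equations give `S(L) = 0`, then `d_h L = 0`, and by differentiating once more `d_h
d_J L = 0`, `S` horizontal, `Φ = i_S R` and `d_R L = 0`. Hence `Φ` annihilates `y` and has its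
values in the kernel of the fibre derivative of `L`.

In dimension two these two facts determine `Φ` up to a factor (`eq_trace_smul_sub`): with `κ = ρ /
L`, `Φ = κ L J - ½ κ d_J L ⊗ C`. So every Finsler surface is isotropic, the form `α = ½ κ d_J L`
exists and is unique, and constant flag curvature means that the function `κ` on `T₀M` is constant.

Both conditions in (b) become conditions on `dκ`. Contraction with `S` gives `W₁(S, η) = ½ L (d_J
κ(η) C - C(κ) Jη)`. An alternating form on a plane is determined by its contraction with one nonzero
vector, so `W₁ = 0` exactly when `d_J κ = 0` (`weylOne_eq_zero_iff`). Since `d_h d_J L = 0`, also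
`d_h α = ½ d_h κ ∧ d_J L` (`dForm_horizontal_eq`). Constant `κ` therefore gives (b).

Conversely, `d_J κ = 0` makes `κ` a function of `x`, because a punctured plane is connected. At each
`x` there is a nonzero `y` with `dκ_x(y) = 0`; evaluating `d_h κ ∧ d_J L = 0` over this `y`, with
`y` as one argument, leaves `2 L dκ_x = 0`. So `κ` is locally constant (`exists_flagCurvature_eq`).
Naturality of spray, projectors and `Φ` under changes of charts makes `κ` a global function, and
connectedness of `M` makes it constant. -/

theorem minSmoothness_two_le_infty : minSmoothness ℝ 2 ≤ (∞ : WithTop ℕ∞) := by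
  rw [minSmoothness_of_isRCLikeNormedField]
  exact WithTop.coe_le_coe.2 le_top

/-! ### Coordinate expressions for the connection, Jacobi endomorphism and curvature of a semispray.
-/

section Semispray

variable {E : Type*} [NormedAddCommGroup E] [NormedSpace ℝ E]

@[simp] theorem J_apply (ξ : E × E) : J ξ = (0, ξ.1) := rfl

/-- A smooth semispray on an open subset of the tangent bundle: a vector field with `J S = C`. -/
structure IsSemispray (S : E × E → E × E) (D : Set (E × E)) : Prop where
  isOpen : IsOpen D
  smooth : ContDiffOn ℝ ∞ S D
  fst_eq : ∀ z ∈ D, (S z).1 = z.2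

/-- The coefficients `Nⁱⱼ` of the nonlinear connection of a semispray:
`h(u, w) = (u, N u)`. -/
def connection (S : E × E → E × E) (z : E × E) : E →L[ℝ] E :=
  (1 / 2 : ℝ) • ((ContinuousLinearMap.snd ℝ E E).comp
    ((fderiv ℝ S z).comp (ContinuousLinearMap.inr ℝ E E)))

theorem connection_apply (S : E × E → E × E) (z : E × E) (u : E) :
    connection S z u = (1 / 2 : ℝ) • (fderiv ℝ S z (0, u)).2 := rfl

/-- The components `Rⁱⱼ` of the Jacobi endomorphism of a semispray. -/
def jacobiMatrix (S : E × E → E × E) (z : E × E) : E →L[ℝ] E :=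
  fderiv ℝ (connection S) z (S z)
    - (ContinuousLinearMap.snd ℝ E E).comp
      ((fderiv ℝ S z).comp (ContinuousLinearMap.inl ℝ E E))
    - (connection S z).comp (connection S z)

theorem jacobiMatrix_apply (S : E × E → E × E) (z : E × E) (u : E) :
    jacobiMatrix S z u = fderiv ℝ (connection S) z (S z) u - (fderiv ℝ S z (u, 0)).2
      - connection S z (connection S z u) := rfl

/-- The components `Rⁱⱼₖ` of the curvature tensor of a semispray. -/
def curvatureMatrix (S : E × E → E × E) (z : E × E) (u u' : E) : E :=
  fderiv ℝ (connection S) z (u, connection S z u) u'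
    - fderiv ℝ (connection S) z (u', connection S z u') u

variable {S : E × E → E × E} {D : Set (E × E)} {z : E × E}

namespace IsSemispray

theorem contDiffAt (h : IsSemispray S D) (hz : z ∈ D) : ContDiffAt ℝ ∞ S z :=
  h.smooth.contDiffAt (h.isOpen.mem_nhds hz)

theorem differentiableAt (h : IsSemispray S D) (hz : z ∈ D) : DifferentiableAt ℝ S z :=
  (h.contDiffAt hz).differentiableAt (by simp)

theorem contDiffAt_fderiv (h : IsSemispray S D) (hz : z ∈ D) :
    ContDiffAt ℝ ∞ (fderiv ℝ S) z :=
  (h.contDiffAt hz).fderiv_right (by simp)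

theorem contDiffAt_connection (h : IsSemispray S D) (hz : z ∈ D) :
    ContDiffAt ℝ ∞ (connection S) z := by
  have := h.contDiffAt_fderiv hz
  unfold connection
  fun_prop

theorem differentiableAt_connection (h : IsSemispray S D) (hz : z ∈ D) :
    DifferentiableAt ℝ (connection S) z :=
  (h.contDiffAt_connection hz).differentiableAt (by simp)

theorem contDiffAt_jacobiMatrix (h : IsSemispray S D) (hz : z ∈ D) :
    ContDiffAt ℝ ∞ (jacobiMatrix S) z := by
  have h1 := h.contDiffAt_fderiv hz
  have h2 := h.contDiffAt_connection hz
  have h3 : ContDiffAt ℝ ∞ (fderiv ℝ (connection S)) z := h2.fderiv_right (by simp)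
  have h4 := h.contDiffAt hz
  unfold jacobiMatrix
  exact ((h3.clm_apply h4).sub
    (contDiffAt_const.clm_comp (h1.clm_comp contDiffAt_const))).sub (h2.clm_comp h2)

theorem fst_fderiv (h : IsSemispray S D) (hz : z ∈ D) (ξ : E × E) :
    (fderiv ℝ S z ξ).1 = ξ.2 := by
  have h1 : (fun z' => (S z').1) =ᶠ[𝓝 z] fun z' => z'.2 :=
    eventually_of_mem (h.isOpen.mem_nhds hz) h.fst_eq
  have h2 := h1.fderiv_eq (𝕜 := ℝ)
  rw [fderiv.fst (h.differentiableAt hz), fderiv_snd] at h2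
  exact congrArg (fun A => A ξ) h2

theorem snd_fderiv_inr (z : E × E) (u : E) :
    (fderiv ℝ S z (0, u)).2 = (2 : ℝ) • connection S z u := by
  rw [connection_apply, smul_smul]; norm_num

/-- As `J` is constant, `[S, J] = J ∘ DS - DS ∘ J`, and `J S = C` determines the first component of
`DS`. What remains is the vertical derivative of `S`, which is `2N`. -/
theorem horizontal_apply (h : IsSemispray S D) (hz : z ∈ D) (ξ : E × E) :
    horizontal S z ξ = (ξ.1, connection S z ξ.1) := by
  have h1 := h.fst_fderiv hz
  ext
  · simp [horizontal, lieD, h1, ← two_smul ℝ, smul_smul]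
  · simp [horizontal, lieD, h1, connection_apply]

theorem vertical_apply (h : IsSemispray S D) (hz : z ∈ D) (ξ : E × E) :
    vertical S z ξ = (0, ξ.2 - connection S z ξ.1) := by
  have h1 := h.fst_fderiv hz
  ext
  · simp [vertical, lieD, h1]
  · simp only [vertical, lieD, fderiv_fun_const, Pi.zero_apply, _root_.zero_apply,
      zero_sub, _root_.smul_apply, _root_.add_apply,
      _root_.neg_apply, ContinuousLinearMap.comp_apply, J_apply, Prod.snd_add,
      Prod.smul_snd, Prod.snd_neg, ContinuousLinearMap.id_apply, h1, connection_apply]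
    module

theorem contDiffAt_horizontal (h : IsSemispray S D) (hz : z ∈ D) :
    ContDiffAt ℝ ∞ (horizontal S) z := by
  have h1 := h.contDiffAt_fderiv hz
  unfold horizontal lieD
  simp only [fderiv_fun_const, Pi.zero_apply, _root_.zero_apply]
  exact (contDiffAt_const (c := (1 / 2 : ℝ))).smul (contDiffAt_const.sub
    ((contDiffAt_const.sub (h1.clm_comp contDiffAt_const)).add (contDiffAt_const.clm_comp h1)))

theorem fderiv_horizontal_apply (h : IsSemispray S D) (hz : z ∈ D) (ζ ξ : E × E) :
    fderiv ℝ (horizontal S) z ζ ξ = (0, fderiv ℝ (connection S) z ζ ξ.1) := by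
  have h1 := h.differentiableAt_connection hz
  have h2 : fderiv ℝ (fun z' => horizontal S z' ξ) z ζ = fderiv ℝ (horizontal S) z ζ ξ := by
    rw [fderiv_clm_apply ((h.contDiffAt_horizontal hz).differentiableAt (by simp))
      (differentiableAt_const _)]
    simp
  have h3 : (fun z' => horizontal S z' ξ) =ᶠ[𝓝 z] fun z' => (ξ.1, connection S z' ξ.1) :=
    eventually_of_mem (h.isOpen.mem_nhds hz) fun z' hz' => h.horizontal_apply hz' ξ
  rw [← h2, h3.fderiv_eq, DifferentiableAt.fderiv_prodMk (differentiableAt_const _)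
    (h1.clm_apply (differentiableAt_const _)), fderiv_clm_apply h1 (differentiableAt_const _)]
  simp

/-- The term `h ∘ DS` of `[S, h]` disappears because `v ∘ h = 0`. The term `DS ∘ h` contributes
`2N²` directly and `-N²` through its first component, hence the single `N²` in `jacobiMatrix`. -/
theorem jacobi_apply (h : IsSemispray S D) (hz : z ∈ D) (ξ : E × E) :
    jacobi S z ξ = (0, jacobiMatrix S z ξ.1) := by
  rw [jacobi, ContinuousLinearMap.comp_apply, h.vertical_apply hz]
  ext
  · rfl
  · have h1 : fderiv ℝ S z (ξ.1, connection S z ξ.1)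
        = fderiv ℝ S z (ξ.1, 0) + fderiv ℝ S z (0, connection S z ξ.1) := by
      rw [← map_add]; simp
    simp only [lieD, _root_.add_apply, _root_.sub_apply,
      ContinuousLinearMap.comp_apply, h.fderiv_horizontal_apply hz, h.horizontal_apply hz,
      h.fst_fderiv hz, h1, Prod.fst_add, Prod.snd_add, Prod.fst_sub, Prod.snd_sub,
      snd_fderiv_inr, jacobiMatrix_apply, map_sub, map_add, map_zero]
    module

theorem trJacobi_eq (h : IsSemispray S D) (hz : z ∈ D) :
    trJacobi S z = LinearMap.trace ℝ E (jacobiMatrix S z : E →ₗ[ℝ] E) := by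
  unfold trJacobi
  congr 1
  ext u
  simp [h.jacobi_apply hz]

theorem curvature_apply (h : IsSemispray S D) (hz : z ∈ D) (ξ η : E × E) :
    curvature S z ξ η = (0, curvatureMatrix S z ξ.1 η.1) := by
  have hd : DifferentiableAt ℝ (horizontal S) z :=
    (h.contDiffAt_horizontal hz).differentiableAt (by simp)
  have h2 (ζ ξ : E × E) : fderiv ℝ (fun z' => horizontal S z' ξ) z ζ
      = (0, fderiv ℝ (connection S) z ζ ξ.1) := by
    rw [← h.fderiv_horizontal_apply hz,
      fderiv_clm_apply hd (differentiableAt_const _)]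
    simp
  simp [curvature, halfBracket, VectorField.lieBracket, h2, h.horizontal_apply hz,
    curvatureMatrix]

theorem snd_fderiv_horizontal (z : E × E) (u : E) :
    (fderiv ℝ S z (u, connection S z u)).2
      = (fderiv ℝ S z (u, 0)).2 + (2 : ℝ) • connection S z (connection S z u) := by
  rw [← snd_fderiv_inr, ← Prod.snd_add, ← map_add]; simp

/-- The vertical derivative of the connection is a second vertical derivative, hence symmetric. -/
theorem fderiv_connection_symm (h : IsSemispray S D) (hz : z ∈ D) (u u' : E) :
    fderiv ℝ (connection S) z (0, u) u' = fderiv ℝ (connection S) z (0, u') u := by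
  have hs : IsSymmSndFDerivAt ℝ S z := (h.contDiffAt hz).isSymmSndFDerivAt minSmoothness_two_le_infty
  have hd : DifferentiableAt ℝ (fderiv ℝ S) z :=
    (h.contDiffAt_fderiv hz).differentiableAt (by simp)
  have key (v v' : E) : fderiv ℝ (connection S) z (0, v) v'
      = (1 / 2 : ℝ) • (fderiv ℝ (fderiv ℝ S) z (0, v) (0, v')).2 := by
    have h1 : fderiv ℝ (fun z' => connection S z' v') z (0, v)
        = fderiv ℝ (connection S) z (0, v) v' := by
      rw [fderiv_clm_apply (h.differentiableAt_connection hz) (differentiableAt_const _)]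
      simp
    rw [← h1]
    simp only [connection_apply]
    have h3 : DifferentiableAt ℝ (fun z' => fderiv ℝ S z' (0, v')) z :=
      hd.clm_apply (differentiableAt_const _)
    rw [fderiv_fun_const_smul h3.snd, fderiv.snd h3, fderiv_clm_apply hd (differentiableAt_const _)]
    simp
  rw [key, key, hs.eq]

end IsSemispray

end Semispray

-- Serves the smoothness of `d d_J L`, since `extD` antisymmetrizes by transposition.
set_option synthInstance.maxHeartbeats 100000 in
theorem contDiff_flip {F G : Type*} [NormedAddCommGroup F] [NormedSpace ℝ F]
    [NormedAddCommGroup G] [NormedSpace ℝ G] :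
    ContDiff ℝ ∞ (fun A : F →L[ℝ] F →L[ℝ] G => A.flip) :=
  LinearIsometryEquiv.contDiff (𝕜 := ℝ) (E := F →L[ℝ] F →L[ℝ] G) (F := F →L[ℝ] F →L[ℝ] G)
    (ContinuousLinearMap.flipₗᵢ ℝ F F G)

/-! ### The spray of a 2-homogeneous regular Lagrangian and its conservation laws. -/

section Lagrangian

variable {E : Type*} [NormedAddCommGroup E] [NormedSpace ℝ E]

/-- A function `L` on an open subset of the tangent bundle which is positively homogeneous of
order 2 (in the form of Euler's identity), and regular. -/
structure IsLagrangian (L : E × E → ℝ) (D : Set (E × E)) : Prop where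
  isOpen : IsOpen D
  smooth : ContDiffOn ℝ ∞ L D
  euler : ∀ z ∈ D, fderiv ℝ L z (0, z.2) = 2 * L z
  nondegenerate : ∀ z ∈ D, ∀ u : E,
    (∀ w : E, fderiv ℝ (fderiv ℝ L) z (0, w) (0, u) = 0) → u = 0

/-- The solution `S` of `i_S d d_J L = -dL`. -/
def lagrangianSpray (L : E × E → ℝ) (z : E × E) : E × E :=
  (extD (dJ L) z).inverse (-fderiv ℝ L z)

theorem geodesicSpray_eq (F : E × E → ℝ) :
    geodesicSpray F = lagrangianSpray fun z => F z ^ 2 := rfl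

namespace IsLagrangian

variable {L : E × E → ℝ} {D : Set (E × E)} {z : E × E}

theorem contDiffAt (h : IsLagrangian L D) (hz : z ∈ D) : ContDiffAt ℝ ∞ L z :=
  h.smooth.contDiffAt (h.isOpen.mem_nhds hz)

theorem differentiableAt (h : IsLagrangian L D) (hz : z ∈ D) : DifferentiableAt ℝ L z :=
  (h.contDiffAt hz).differentiableAt (by simp)

theorem contDiffAt_fderiv (h : IsLagrangian L D) (hz : z ∈ D) :
    ContDiffAt ℝ ∞ (fderiv ℝ L) z :=
  (h.contDiffAt hz).fderiv_right (by simp)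

theorem differentiableAt_fderiv (h : IsLagrangian L D) (hz : z ∈ D) :
    DifferentiableAt ℝ (fderiv ℝ L) z :=
  (h.contDiffAt_fderiv hz).differentiableAt (by simp)

theorem symm (h : IsLagrangian L D) (hz : z ∈ D) (ξ η : E × E) :
    fderiv ℝ (fderiv ℝ L) z ξ η = fderiv ℝ (fderiv ℝ L) z η ξ :=
  ((h.contDiffAt hz).isSymmSndFDerivAt minSmoothness_two_le_infty).eq ξ η

/-- The derivative of `z ↦ dL_z(X z)`. -/
theorem fderiv_fderiv_apply (h : IsLagrangian L D) (hz : z ∈ D) {X : E × E → E × E}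
    (hX : DifferentiableAt ℝ X z) (ξ : E × E) :
    fderiv ℝ (fun z' => fderiv ℝ L z' (X z')) z ξ
      = fderiv ℝ (fderiv ℝ L) z ξ (X z) + fderiv ℝ L z (fderiv ℝ X z ξ) := by
  rw [fderiv_clm_apply (h.differentiableAt_fderiv hz) hX]
  simp [add_comm]

/-- The derivative of an identity `dL(X) = c L` valid on `D`. -/
theorem fderiv_identity (h : IsLagrangian L D) (hz : z ∈ D) {X : E × E → E × E} {c : ℝ}
    (hX : DifferentiableAt ℝ X z) (hL : ∀ z' ∈ D, fderiv ℝ L z' (X z') = c * L z') (ξ : E × E) :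
    fderiv ℝ (fderiv ℝ L) z ξ (X z) + fderiv ℝ L z (fderiv ℝ X z ξ) = c * fderiv ℝ L z ξ := by
  rw [← h.fderiv_fderiv_apply hz hX]
  have h1 : (fun z' => fderiv ℝ L z' (X z')) =ᶠ[𝓝 z] fun z' => c * L z' :=
    eventually_of_mem (h.isOpen.mem_nhds hz) hL
  rw [h1.fderiv_eq, fderiv_const_mul (h.differentiableAt hz)]
  simp

/-- The derivative of Euler's identity; this is the form in which homogeneity is mostly used below.
-/
theorem hessian_liouville (h : IsLagrangian L D) (hz : z ∈ D) (ξ : E × E) :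
    fderiv ℝ (fderiv ℝ L) z ξ (0, z.2) + fderiv ℝ L z (0, ξ.2) = 2 * fderiv ℝ L z ξ := by
  have h1 : DifferentiableAt ℝ (fun z' : E × E => ((0 : E), z'.2)) z := by fun_prop
  have h2 := h.fderiv_identity hz h1 h.euler ξ
  rwa [DifferentiableAt.fderiv_prodMk (by fun_prop) (by fun_prop), fderiv_snd,
    fderiv_fun_const] at h2

theorem dJ_apply (L : E × E → ℝ) (z ξ : E × E) : dJ L z ξ = fderiv ℝ L z (0, ξ.1) := rfl

theorem fderiv_dJ_apply (h : IsLagrangian L D) (hz : z ∈ D) (ξ η : E × E) :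
    fderiv ℝ (dJ L) z ξ η = fderiv ℝ (fderiv ℝ L) z ξ (0, η.1) := by
  unfold dJ
  rw [fderiv_clm_comp (h.differentiableAt_fderiv hz) (differentiableAt_const _)]
  simp

theorem contDiffAt_dJ (h : IsLagrangian L D) (hz : z ∈ D) : ContDiffAt ℝ ∞ (dJ L) z :=
  (h.contDiffAt_fderiv hz).clm_comp contDiffAt_const

theorem extD_dJ_apply (h : IsLagrangian L D) (hz : z ∈ D) (ξ η : E × E) :
    extD (dJ L) z ξ η
      = fderiv ℝ (fderiv ℝ L) z ξ (0, η.1) - fderiv ℝ (fderiv ℝ L) z η (0, ξ.1) := by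
  simp [extD, h.fderiv_dJ_apply hz]

theorem contDiffAt_extD_dJ (h : IsLagrangian L D) (hz : z ∈ D) :
    ContDiffAt ℝ ∞ (extD (dJ L)) z := by
  have h1 : ContDiffAt ℝ ∞ (fderiv ℝ (dJ L)) z := (h.contDiffAt_dJ hz).fderiv_right (by simp)
  exact h1.sub (contDiff_flip.contDiffAt.comp z h1)

/-- In block form `d d_J L` has the fibre Hessian off the diagonal and zero in the vertical block.
Testing on vertical vectors kills the first component, and then testing on vectors `(u', 0)` kills
the second. -/
theorem extD_dJ_injective (h : IsLagrangian L D) (hz : z ∈ D) :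
    Function.Injective (extD (dJ L) z) := by
  rw [injective_iff_map_eq_zero]
  rintro ⟨u, w⟩ h0
  have h1 (η : E × E) : fderiv ℝ (fderiv ℝ L) z (u, w) (0, η.1)
      - fderiv ℝ (fderiv ℝ L) z η (0, u) = 0 := by
    rw [← h.extD_dJ_apply hz (u, w) η, h0]; rfl
  have hu : u = 0 := h.nondegenerate z hz u fun w' => by
    have := h1 (0, w')
    simpa [← Prod.zero_eq_mk] using this
  subst hu
  have hw : w = 0 := h.nondegenerate z hz w fun u' => by
    have := h1 (u', 0)
    rw [h.symm hz]
    simpa [← Prod.zero_eq_mk] using this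
  rw [hw]; rfl

section FiniteDimensional

variable [FiniteDimensional ℝ E]

/-- Injectivity suffices by equality of dimensions. It ensures that `ContinuousLinearMap.inverse` in
the definition of the spray is the true inverse and not its default value `0`. -/
theorem exists_equiv_extD_dJ (h : IsLagrangian L D) (hz : z ∈ D) :
    ∃ e : (E × E) ≃L[ℝ] (E × E →L[ℝ] ℝ), (e : E × E →L[ℝ] E × E →L[ℝ] ℝ) = extD (dJ L) z := by
  have hr : Module.finrank ℝ (E × E) = Module.finrank ℝ (E × E →L[ℝ] ℝ) := by
    rw [← (LinearMap.toContinuousLinearMap (𝕜 := ℝ) (E := E × E) (F' := ℝ)).finrank_eq]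
    exact (Subspace.dual_finrank_eq (K := ℝ) (V := E × E)).symm
  refine ⟨(LinearEquiv.ofInjectiveOfFinrankEq (extD (dJ L) z : E × E →ₗ[ℝ] _)
    (h.extD_dJ_injective hz) hr).toContinuousLinearEquiv, ?_⟩
  ext <;> rfl

theorem extD_spray (h : IsLagrangian L D) (hz : z ∈ D) :
    extD (dJ L) z (lagrangianSpray L z) = -fderiv ℝ L z := by
  obtain ⟨e, he⟩ := h.exists_equiv_extD_dJ hz
  rw [lagrangianSpray, ← he, ContinuousLinearMap.inverse_equiv]
  simp

theorem contDiffAt_spray (h : IsLagrangian L D) (hz : z ∈ D) :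
    ContDiffAt ℝ ∞ (lagrangianSpray L) z := by
  obtain ⟨e, he⟩ := h.exists_equiv_extD_dJ hz
  have h1 : ContDiffAt ℝ ∞ ContinuousLinearMap.inverse (extD (dJ L) z) :=
    he ▸ contDiffAt_map_inverse e
  exact (h1.comp z (h.contDiffAt_extD_dJ hz)).clm_apply (h.contDiffAt_fderiv hz).neg

/-- On vertical vectors the defining equation says that the fibre Hessian sends `S.1` to `∂L/∂y`. By
homogeneity it sends `y` to the same covector, and it is nondegenerate. -/
theorem spray_fst (h : IsLagrangian L D) (hz : z ∈ D) : (lagrangianSpray L z).1 = z.2 := by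
  rw [← sub_eq_zero]
  refine h.nondegenerate z hz _ fun w => ?_
  have h1 := h.extD_dJ_apply hz (lagrangianSpray L z) (0, w)
  rw [h.extD_spray hz] at h1
  have h2 := h.hessian_liouville hz (0, w)
  have h3 : ((0 : E), (lagrangianSpray L z).1 - z.2)
    = (0, (lagrangianSpray L z).1) - (0, z.2) := by simp
  simp only [_root_.neg_apply, ← Prod.zero_eq_mk, map_zero] at h1
  rw [h3, map_sub]
  linarith

/-- The Euler–Lagrange equations `S(∂L/∂yⁱ) = ∂L/∂xⁱ`. -/
theorem euler_lagrange (h : IsLagrangian L D) (hz : z ∈ D) (u : E) :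
    fderiv ℝ (fderiv ℝ L) z (lagrangianSpray L z) (0, u) = fderiv ℝ L z (u, 0) := by
  have h1 := h.extD_dJ_apply hz (lagrangianSpray L z) (u, 0)
  rw [h.extD_spray hz, h.spray_fst hz] at h1
  have h2 := h.hessian_liouville hz (u, 0)
  simp only [_root_.neg_apply, ← Prod.zero_eq_mk, map_zero] at h1 h2
  linarith

theorem isSemispray (h : IsLagrangian L D) : IsSemispray (lagrangianSpray L) D :=
  ⟨h.isOpen, fun _ hz => (h.contDiffAt_spray hz).contDiffWithinAt, fun _ hz => h.spray_fst hz⟩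

/-- A Lagrangian homogeneous of order 2 is a first integral of its spray. -/
theorem fderiv_spray (h : IsLagrangian L D) (hz : z ∈ D) :
    fderiv ℝ L z (lagrangianSpray L z) = 0 := by
  have h1 := h.hessian_liouville hz (lagrangianSpray L z)
  rw [h.euler_lagrange hz] at h1
  have h2 : lagrangianSpray L z = (z.2, 0) + (0, (lagrangianSpray L z).2) := by
    rw [← h.spray_fst hz]; simp
  have h3 := congrArg (fderiv ℝ L z) h2
  rw [map_add] at h3
  linarith

/-- `d_h L = 0`. -/
theorem fderiv_horizontal (h : IsLagrangian L D) (hz : z ∈ D) (u : E) :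
    fderiv ℝ L z (u, connection (lagrangianSpray L) z u) = 0 := by
  have hS := h.isSemispray
  have h1 := h.fderiv_identity hz (c := 0) (hS.differentiableAt hz)
    (fun z' hz' => by rw [h.fderiv_spray hz', zero_mul]) (0, u)
  rw [h.symm hz, h.euler_lagrange hz] at h1
  have h2 : fderiv ℝ (lagrangianSpray L) z (0, u)
      = (u, 0) + (2 : ℝ) • (0, connection (lagrangianSpray L) z u) := by
    ext
    · simp [hS.fst_fderiv hz]
    · simp [IsSemispray.snd_fderiv_inr]
  have h3 : (u, connection (lagrangianSpray L) z u)
      = (u, 0) + (0, connection (lagrangianSpray L) z u) := by simp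
  rw [h2, map_add, map_smul, smul_eq_mul] at h1
  rw [h3, map_add]
  linarith

/-- The derivative of `d_h L = 0`. -/
theorem hessian_horizontal (h : IsLagrangian L D) (hz : z ∈ D) (u : E) (ξ : E × E) :
    fderiv ℝ (fderiv ℝ L) z ξ (u, connection (lagrangianSpray L) z u)
      + fderiv ℝ L z (0, fderiv ℝ (connection (lagrangianSpray L)) z ξ u) = 0 := by
  have hN := h.isSemispray.differentiableAt_connection hz
  have hN' : DifferentiableAt ℝ (fun z' => connection (lagrangianSpray L) z' u) z :=
    hN.clm_apply (differentiableAt_const _)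
  have h1 := h.fderiv_identity hz (c := 0)
    (X := fun z' => (u, connection (lagrangianSpray L) z' u)) ((differentiableAt_const _).prodMk hN')
    (fun z' hz' => by rw [h.fderiv_horizontal hz', zero_mul]) ξ
  rw [DifferentiableAt.fderiv_prodMk (differentiableAt_const _) hN',
    fderiv_clm_apply hN (differentiableAt_const _)] at h1
  simpa using h1

/-- `d_h d_J L = 0`. -/
theorem hessian_horizontal_symm (h : IsLagrangian L D) (hz : z ∈ D) (u u' : E) :
    fderiv ℝ (fderiv ℝ L) z (u, connection (lagrangianSpray L) z u) (0, u')
      = fderiv ℝ (fderiv ℝ L) z (u', connection (lagrangianSpray L) z u') (0, u) := by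
  have h1 := h.hessian_horizontal hz u (0, u')
  have h2 := h.hessian_horizontal hz u' (0, u)
  rw [h.isSemispray.fderiv_connection_symm hz] at h1
  rw [h.symm hz, h.symm hz (u', _)]
  linarith

/-- `N y = g`, where `S = (y, g)`: the spray is horizontal. -/
theorem connection_liouville (h : IsLagrangian L D) (hz : z ∈ D) :
    connection (lagrangianSpray L) z z.2 = (lagrangianSpray L z).2 := by
  rw [← sub_eq_zero]
  refine h.nondegenerate z hz _ fun u => ?_
  -- The Hessian pairs both `(y, N y)` and `S` with `(0, u)` to `∂L/∂x(u)`: the first by the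
  -- symmetry `d_h d_J L = 0`, homogeneity and `d_h L = 0`, the second by Euler–Lagrange. Their
  -- difference is vertical, so nondegeneracy applies.
  have h1 := h.hessian_horizontal_symm hz z.2 u
  have h2 := h.hessian_liouville hz (u, connection (lagrangianSpray L) z u)
  have h3 := h.euler_lagrange hz u
  have h4 := h.fderiv_horizontal hz u
  have h5 : (0, connection (lagrangianSpray L) z z.2 - (lagrangianSpray L z).2)
      = (z.2, connection (lagrangianSpray L) z z.2) - lagrangianSpray L z := by
    ext
    · simp [h.spray_fst hz]
    · simp
  have h6 : fderiv ℝ L z (u, connection (lagrangianSpray L) z u) = fderiv ℝ L z (u, 0)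
      + fderiv ℝ L z (0, connection (lagrangianSpray L) z u) := by
    rw [← map_add]; simp
  rw [h.symm hz, h5, map_sub, _root_.sub_apply]
  linarith

theorem spray_eq (h : IsLagrangian L D) (hz : z ∈ D) :
    lagrangianSpray L z = (z.2, connection (lagrangianSpray L) z z.2) := by
  ext
  · exact h.spray_fst hz
  · exact (h.connection_liouville hz).symm

/-- The derivative of `N y = g`. -/
theorem fderiv_connection_liouville (h : IsLagrangian L D) (hz : z ∈ D) (ξ : E × E) :
    fderiv ℝ (connection (lagrangianSpray L)) z ξ z.2 + connection (lagrangianSpray L) z ξ.2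
      = (fderiv ℝ (lagrangianSpray L) z ξ).2 := by
  have hS := h.isSemispray
  have h1 : (fun z' => connection (lagrangianSpray L) z' z'.2)
      =ᶠ[𝓝 z] fun z' => (lagrangianSpray L z').2 :=
    eventually_of_mem (h.isOpen.mem_nhds hz) fun z' hz' => h.connection_liouville hz'
  have h2 := h1.fderiv_eq (𝕜 := ℝ)
  rw [fderiv_clm_apply (hS.differentiableAt_connection hz) differentiableAt_snd,
    fderiv.snd (hS.differentiableAt hz), fderiv_snd] at h2
  have h3 := congrArg (fun A => A ξ) h2
  simpa [add_comm] using h3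

/-- `Φ = i_S R`. -/
theorem curvatureMatrix_liouville (h : IsLagrangian L D) (hz : z ∈ D) (u : E) :
    curvatureMatrix (lagrangianSpray L) z z.2 u = jacobiMatrix (lagrangianSpray L) z u := by
  have h1 := h.fderiv_connection_liouville hz (u, connection (lagrangianSpray L) z u)
  rw [IsSemispray.snd_fderiv_horizontal] at h1
  rw [curvatureMatrix, ← h.spray_eq hz, jacobiMatrix_apply, eq_sub_of_add_eq h1]
  module

theorem jacobiMatrix_liouville (h : IsLagrangian L D) (hz : z ∈ D) :
    jacobiMatrix (lagrangianSpray L) z z.2 = 0 := by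
  rw [← h.curvatureMatrix_liouville hz, curvatureMatrix, sub_self]

/-- `d_R L = 0`. -/
theorem fderiv_curvatureMatrix (h : IsLagrangian L D) (hz : z ∈ D) (u u' : E) :
    fderiv ℝ L z (0, curvatureMatrix (lagrangianSpray L) z u u') = 0 := by
  -- Differentiate `d_h L = 0` horizontally and antisymmetrize: the Hessian of `L` on the two
  -- horizontal lifts cancels and only the curvature is left.
  have h1 := h.hessian_horizontal hz u' (u, connection (lagrangianSpray L) z u)
  have h2 := h.hessian_horizontal hz u (u', connection (lagrangianSpray L) z u')
  rw [h.symm hz] at h1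
  have h3 : (0, curvatureMatrix (lagrangianSpray L) z u u')
    = ((0 : E), fderiv ℝ (connection (lagrangianSpray L)) z
        (u, connection (lagrangianSpray L) z u) u')
      - (0, fderiv ℝ (connection (lagrangianSpray L)) z
        (u', connection (lagrangianSpray L) z u') u) := by
    simp [curvatureMatrix]
  rw [h3, map_sub]
  linarith

theorem fderiv_jacobiMatrix (h : IsLagrangian L D) (hz : z ∈ D) (u : E) :
    fderiv ℝ L z (0, jacobiMatrix (lagrangianSpray L) z u) = 0 := by
  rw [← h.curvatureMatrix_liouville hz, h.fderiv_curvatureMatrix hz]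

end FiniteDimensional

end IsLagrangian

end Lagrangian

/-! ### Linear algebra in a plane. -/

section Plane

variable {E : Type*} [NormedAddCommGroup E] [NormedSpace ℝ E]

/-- In a plane, a vector `y` with `ℓ y ≠ 0` is completed to a basis by a vector `b` of `ker ℓ`. -/
theorem exists_mem_ker_decomposition (hE : Module.finrank ℝ E = 2) {ℓ : E →L[ℝ] ℝ} {y : E}
    (hy : ℓ y ≠ 0) :
    ∃ b : E, b ≠ 0 ∧ ℓ b = 0 ∧ ∀ u, ∃ c : ℝ, u = (ℓ u / ℓ y) • y + c • b := by
  have : FiniteDimensional ℝ E := Module.finite_of_finrank_pos (by omega)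
  have h1 := LinearMap.finrank_range_add_finrank_ker (ℓ : E →ₗ[ℝ] ℝ)
  have h2 : LinearMap.range (ℓ : E →ₗ[ℝ] ℝ) = ⊤ :=
    LinearMap.range_eq_top.2 fun t => ⟨(t / ℓ y) • y, by simp [hy]⟩
  rw [h2, finrank_top, Module.finrank_self, hE] at h1
  obtain ⟨⟨b, hb⟩, hb0, hspan⟩ := (finrank_eq_one_iff' (K := ℝ)
    (V := LinearMap.ker (ℓ : E →ₗ[ℝ] ℝ))).1 (by omega)
  refine ⟨b, fun h => hb0 (Subtype.ext h), hb, fun u => ?_⟩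
  obtain ⟨c, hc⟩ := hspan ⟨u - (ℓ u / ℓ y) • y, by simp [hy]⟩
  refine ⟨c, ?_⟩
  have h3 : c • b = u - (ℓ u / ℓ y) • y := congrArg Subtype.val hc
  rw [h3]; abel

/-- In a plane, an endomorphism which kills `y` and has its values in `ker ℓ`, where `ℓ y ≠ 0`, is
a multiple of the projection onto `ker ℓ` along `y`. -/
theorem eq_trace_smul_sub (hE : Module.finrank ℝ E = 2) {ℓ : E →L[ℝ] ℝ} {y : E}
    (hy : ℓ y ≠ 0) {A : E →L[ℝ] E} (hA : A y = 0) (hℓ : ∀ u, ℓ (A u) = 0) (u : E) :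
    A u = LinearMap.trace ℝ E (A : E →ₗ[ℝ] E) • (u - (ℓ u / ℓ y) • y) := by
  have : FiniteDimensional ℝ E := Module.finite_of_finrank_pos (by omega)
  obtain ⟨b, -, hb, hdec⟩ := exists_mem_ker_decomposition hE hy
  obtain ⟨c, hc⟩ := hdec (A b)
  have hA' : (A : E →ₗ[ℝ] E)
      = c • (LinearMap.id - (ℓ y)⁻¹ • (ℓ : E →ₗ[ℝ] ℝ).smulRight y) := by
    ext v
    obtain ⟨d, hd⟩ := hdec v
    have h1 : A v = d • c • b := by
      conv_lhs => rw [hd]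
      rw [map_add, map_smul, map_smul, hA, hc, hℓ]
      simp
    have h2 : d • b = v - (ℓ v / ℓ y) • y := eq_sub_of_add_eq' hd.symm
    rw [smul_comm, h2] at h1
    simp [h1, smul_smul, div_eq_inv_mul]
  -- The projection onto `ker ℓ` along `y` has trace `2 - 1 = 1`.
  have htr : LinearMap.trace ℝ E (A : E →ₗ[ℝ] E) = c := by
    rw [hA', map_smul, map_sub, map_smul, LinearMap.trace_id, LinearMap.trace_smulRight, hE]
    simp [hy]; norm_num
  rw [htr]
  have := congrArg (fun B => B u) hA'
  simpa [smul_smul, div_eq_inv_mul] using this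

/-- In a plane, an alternating bilinear map `(u, u') ↦ A u u' - A u' u` which vanishes for one
nonzero `u = y` vanishes. -/
theorem apply_eq_apply_of_forall (hE : Module.finrank ℝ E = 2) {y : E} (hy : y ≠ 0)
    {A : E →ₗ[ℝ] E →ₗ[ℝ] E} (hA : ∀ u, A y u = A u y) (u u' : E) : A u u' = A u' u := by
  obtain ⟨ℓ, hℓ⟩ := exists_dual_vector ℝ y (norm_ne_zero_iff.2 hy)
  have hℓy : ℓ y ≠ 0 := by
    rw [hℓ.2]; simpa using hy
  obtain ⟨b, -, -, hdec⟩ := exists_mem_ker_decomposition hE hℓy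
  obtain ⟨c, hc⟩ := hdec u
  obtain ⟨c', hc'⟩ := hdec u'
  rw [hc, hc']
  simp only [map_add, map_smul, LinearMap.add_apply, LinearMap.smul_apply, hA b]
  module

end Plane

/-! ### Flag curvature of a surface, and both conditions of (b) in terms of its differential. -/

section Surface

variable {E : Type*} [NormedAddCommGroup E] [NormedSpace ℝ E]

/-- The flag curvature `ρ / L` of a Finsler surface with `L = F²`. -/
def flagCurvature (L : E × E → ℝ) (z : E × E) : ℝ := ricci (lagrangianSpray L) z / L z

theorem ricci_eq (hE : Module.finrank ℝ E = 2) (S : E × E → E × E) : ricci S = trJacobi S := by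
  ext z
  rw [ricci, hE]; norm_num

theorem IsSemispray.contDiffAt_ricci [FiniteDimensional ℝ E] {S : E × E → E × E}
    {D : Set (E × E)} {z : E × E} (h : IsSemispray S D) (hz : z ∈ D) :
    ContDiffAt ℝ ∞ (ricci S) z := by
  have h1 : trJacobi S =ᶠ[𝓝 z] fun z' =>
      LinearMap.toContinuousLinearMap ((LinearMap.trace ℝ E).comp
        (ContinuousLinearMap.coeLM ℝ : (E →L[ℝ] E) →ₗ[ℝ] E →ₗ[ℝ] E))
        (jacobiMatrix S z') :=
    eventually_of_mem (h.isOpen.mem_nhds hz) fun z' hz' => h.trJacobi_eq hz'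
  have h2 : ContDiffAt ℝ ∞ (trJacobi S) z :=
    ((ContinuousLinearMap.contDiff _).contDiffAt.comp z
      (h.contDiffAt_jacobiMatrix hz)).congr_of_eventuallyEq h1
  exact contDiffAt_const.mul h2

namespace IsLagrangian

variable {L : E × E → ℝ} {D : Set (E × E)} {z : E × E}

theorem mono (h : IsLagrangian L D) {D' : Set (E × E)} (hD' : IsOpen D') (hs : D' ⊆ D) :
    IsLagrangian L D' :=
  ⟨hD', h.smooth.mono hs, fun z hz => h.euler z (hs hz), fun z hz => h.nondegenerate z (hs hz)⟩

theorem contDiffAt_flagCurvature [FiniteDimensional ℝ E] (h : IsLagrangian L D) (hz : z ∈ D)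
    (hL : L z ≠ 0) : ContDiffAt ℝ ∞ (flagCurvature L) z :=
  (h.isSemispray.contDiffAt_ricci hz).div (h.contDiffAt hz) hL

theorem snd_ne_zero (h : IsLagrangian L D) (hz : z ∈ D) (hL : L z ≠ 0) : z.2 ≠ 0 := by
  intro h0
  have := h.euler z hz
  rw [h0, ← Prod.zero_eq_mk, map_zero] at this
  simp_all

/-- The restriction of `dL` to the fibre directions. -/
theorem exists_verticalDerivative (L : E × E → ℝ) (z : E × E) :
    ∃ ℓ : E →L[ℝ] ℝ, ∀ u, ℓ u = fderiv ℝ L z (0, u) :=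
  ⟨(fderiv ℝ L z).comp (ContinuousLinearMap.inr ℝ E E), fun _ => rfl⟩

/-- Isotropy is automatic here: `Φ` kills `y` and `dL` kills its values, so `Φ` is its trace times a
projection. The factor `1 / 2` comes from `∂L/∂y(y) = 2L`. -/
theorem jacobiMatrix_eq (h : IsLagrangian L D) (hE : Module.finrank ℝ E = 2) (hz : z ∈ D)
    (hL : L z ≠ 0) (u : E) :
    jacobiMatrix (lagrangianSpray L) z u = (flagCurvature L z * L z) • u
      - (1 / 2 * flagCurvature L z * fderiv ℝ L z (0, u)) • z.2 := by
  have : FiniteDimensional ℝ E := Module.finite_of_finrank_pos (by omega)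
  obtain ⟨ℓ, hℓ⟩ := exists_verticalDerivative L z
  have h2 := h.euler z hz
  have hy : ℓ z.2 ≠ 0 := by rw [hℓ, h2]; simpa using hL
  rw [eq_trace_smul_sub hE hy (h.jacobiMatrix_liouville hz)
    (fun u => by rw [hℓ, h.fderiv_jacobiMatrix hz]) u, flagCurvature, ricci_eq hE,
    h.isSemispray.trJacobi_eq hz, hℓ, hℓ, h2, smul_sub, smul_smul]
  congr 2 <;> field_simp

theorem trJacobi_eq (hE : Module.finrank ℝ E = 2)
    (hL : L z ≠ 0) : trJacobi (lagrangianSpray L) z = flagCurvature L z * L z := by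
  rw [flagCurvature, ricci_eq hE, div_mul_cancel₀ _ hL]

theorem jacobi_eq (h : IsLagrangian L D) (hE : Module.finrank ℝ E = 2) (hz : z ∈ D)
    (hL : L z ≠ 0) :
    jacobi (lagrangianSpray L) z = ricci (lagrangianSpray L) z • J
      - ((1 / 2 * flagCurvature L z) • dJ L z).smulRight (liouville z) := by
  have : FiniteDimensional ℝ E := Module.finite_of_finrank_pos (by omega)
  refine ContinuousLinearMap.ext fun ξ => ?_
  rw [h.isSemispray.jacobi_apply hz, h.jacobiMatrix_eq hE hz hL, flagCurvature,
    div_mul_cancel₀ _ hL]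
  simp [liouville, dJ_apply]

/-- The form `α` in `Φ = ρ J - α ⊗ C` is unique. -/
theorem eq_of_jacobi_eq (h : IsLagrangian L D) (hE : Module.finrank ℝ E = 2) (hz : z ∈ D)
    (hL : L z ≠ 0) {θ : E × E →L[ℝ] ℝ}
    (hθ : jacobi (lagrangianSpray L) z = ricci (lagrangianSpray L) z • J
      - θ.smulRight (liouville z)) :
    θ = (1 / 2 * flagCurvature L z) • dJ L z := by
  rw [h.jacobi_eq hE hz hL, sub_right_inj] at hθ
  refine ContinuousLinearMap.ext fun ξ => ?_
  have h1 := congrArg (fun A => (A ξ).2) hθ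
  exact (smul_left_injective ℝ (h.snd_ne_zero hz hL) h1).symm

/-- Here `i_S R = Φ` and `d_J(Tr Φ) = L d_J κ + κ d_J L`; the terms in `κ` itself cancel, which is
what the coefficient `1 / 2` in `W₁` achieves. -/
theorem weylOne_liouville (h : IsLagrangian L D) (hE : Module.finrank ℝ E = 2) (hz : z ∈ D)
    (hL : L z ≠ 0) (ξ η : E × E) (hξ : ξ.1 = z.2) :
    weylOne (lagrangianSpray L) z ξ η = (0, (1 / 2 * L z) •
      (fderiv ℝ (flagCurvature L) z (0, η.1) • z.2
        - fderiv ℝ (flagCurvature L) z (0, z.2) • η.1)) := by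
  have : FiniteDimensional ℝ E := Module.finite_of_finrank_pos (by omega)
  have hev : trJacobi (lagrangianSpray L) =ᶠ[𝓝 z] fun z' => flagCurvature L z' * L z' := by
    filter_upwards [(h.contDiffAt hz).continuousAt.eventually_ne hL] with z' hz'
    exact trJacobi_eq hE hz'
  have hd (u : E) : dJ (trJacobi (lagrangianSpray L)) z (u, 0)
      = fderiv ℝ (flagCurvature L) z (0, u) * L z
        + flagCurvature L z * fderiv ℝ L z (0, u) := by
    rw [dJ, hev.fderiv_eq, fderiv_fun_mul
      ((h.contDiffAt_flagCurvature hz hL).differentiableAt (by simp)) (h.differentiableAt hz)]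
    simp [J_apply]; ring
  have hd' (ξ : E × E) : dJ (trJacobi (lagrangianSpray L)) z ξ
      = dJ (trJacobi (lagrangianSpray L)) z (ξ.1, 0) := rfl
  rw [weylOne, h.isSemispray.curvature_apply hz, hE, wedgeJ, hd' ξ, hd' η, hd, hd, hξ,
    h.curvatureMatrix_liouville hz, h.jacobiMatrix_eq hE hz hL, h.euler z hz]
  ext
  · simp
  · simp only [J_apply, hξ, Prod.snd_sub, Prod.smul_snd, Nat.cast_ofNat]
    match_scalars <;> ring

/-- `W₁ = 0` if and only if the flag curvature depends on the position only. -/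
theorem weylOne_eq_zero_iff (h : IsLagrangian L D) (hE : Module.finrank ℝ E = 2) (hz : z ∈ D)
    (hL : L z ≠ 0) :
    (∀ ξ η, weylOne (lagrangianSpray L) z ξ η = 0)
      ↔ ∀ u, fderiv ℝ (flagCurvature L) z (0, u) = 0 := by
  have : FiniteDimensional ℝ E := Module.finite_of_finrank_pos (by omega)
  obtain ⟨ℓ, hℓ⟩ := exists_verticalDerivative L z
  have hy : ℓ z.2 ≠ 0 := by rw [hℓ, h.euler z hz]; simpa using hL
  obtain ⟨b, hb0, hb, hdec⟩ := exists_mem_ker_decomposition hE hy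
  constructor
  · intro hW
    -- As `b` and `y` are independent, this identity at `u = b` forces `dκ` to vanish on `b` and on
    -- `y`.
    have key (u : E) : fderiv ℝ (flagCurvature L) z (0, u) • z.2
        = fderiv ℝ (flagCurvature L) z (0, z.2) • u := by
      have h1 := h.weylOne_liouville hE hz hL (z.2, 0) (u, 0) rfl
      rw [hW, eq_comm, Prod.mk_eq_zero, smul_eq_zero] at h1
      rcases h1.2 with h2 | h2
      · exact absurd h2 (by simpa using hL)
      · exact sub_eq_zero.1 h2
    have h1 : fderiv ℝ (flagCurvature L) z (0, b) = 0 := by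
      have := congrArg ℓ (key b)
      rw [map_smul, map_smul, hb, smul_zero, smul_eq_zero] at this
      exact this.resolve_right hy
    have h2 : fderiv ℝ (flagCurvature L) z (0, z.2) = 0 := by
      have := key b
      rw [h1, zero_smul, eq_comm, smul_eq_zero] at this
      exact this.resolve_right hb0
    intro u
    have := key u
    rw [h2, zero_smul, smul_eq_zero] at this
    exact this.resolve_right (h.snd_ne_zero hz hL)
  · intro hκ
    set N := connection (lagrangianSpray L)
    set θ := dJ (trJacobi (lagrangianSpray L)) z with hθ
    -- Half of `W₁` before antisymmetrization. Its antisymmetrization vanishes as soon as its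
    -- contraction with the single vector `y` does.
    let A : E →ₗ[ℝ] E →ₗ[ℝ] E := LinearMap.mk₂ ℝ
      (fun u u' => fderiv ℝ N z (u, N z u) u' - (1 / 2 : ℝ) • θ (u, 0) • u')
      (fun u v w => by
        have h1 : (u + v, N z (u + v)) = (u, N z u) + (v, N z v) := by simp
        have h2 : (u + v, (0 : E)) = (u, 0) + (v, 0) := by simp
        rw [h1, h2, map_add, map_add, _root_.add_apply]
        module)
      (fun c u w => by
        have h1 : (c • u, N z (c • u)) = c • (u, N z u) := by simp
        have h2 : (c • u, (0 : E)) = c • (u, 0) := by simp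
        rw [h1, h2, map_smul, map_smul, _root_.smul_apply, smul_eq_mul]
        module)
      (fun u v w => by rw [map_add]; module)
      (fun c u w => by rw [map_smul]; module)
    have hA (ξ η : E × E) : weylOne (lagrangianSpray L) z ξ η
        = (0, A ξ.1 η.1 - A η.1 ξ.1) := by
      have hθ' (ξ : E × E) : θ ξ = θ (ξ.1, 0) := rfl
      rw [weylOne, h.isSemispray.curvature_apply hz, hE, wedgeJ, ← hθ, hθ' ξ, hθ' η]
      ext
      · simp
      · simp only [A, LinearMap.mk₂_apply, J_apply, Prod.snd_sub, Prod.smul_snd, Nat.cast_ofNat,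
          curvatureMatrix]
        module
    have hA' := apply_eq_apply_of_forall hE (h.snd_ne_zero hz hL) (A := A) fun u => by
      have h1 := hA (z.2, 0) (u, 0)
      rw [h.weylOne_liouville hE hz hL _ _ rfl, hκ, hκ, Prod.mk.injEq] at h1
      refine sub_eq_zero.1 (h1.2.symm.trans ?_)
      rw [zero_smul, zero_smul, sub_zero, smul_zero]
    intro ξ η
    rw [hA, hA', sub_self]; rfl

theorem fderiv_half_smul_dJ_apply [FiniteDimensional ℝ E] (h : IsLagrangian L D) (hz : z ∈ D)
    (hL : L z ≠ 0) (ξ η : E × E) :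
    fderiv ℝ (fun z' => (1 / 2 * flagCurvature L z') • dJ L z') z ξ η
      = 1 / 2 * flagCurvature L z * fderiv ℝ (fderiv ℝ L) z ξ (0, η.1)
        + 1 / 2 * fderiv ℝ (flagCurvature L) z ξ * fderiv ℝ L z (0, η.1) := by
  have hκ : DifferentiableAt ℝ (flagCurvature L) z :=
    (h.contDiffAt_flagCurvature hz hL).differentiableAt (by simp)
  rw [fderiv_fun_smul (hκ.const_mul _) ((h.contDiffAt_dJ hz).differentiableAt (by simp)),
    fderiv_const_mul hκ]
  simp [h.fderiv_dJ_apply hz, dJ_apply]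

/-- `d_h (½ κ d_J L) = ½ d_h κ ∧ d_J L`. -/
theorem dForm_horizontal_eq [FiniteDimensional ℝ E] (h : IsLagrangian L D) (hz : z ∈ D)
    (hL : L z ≠ 0) {θ : E × E → E × E →L[ℝ] ℝ}
    (hθ : ∀ z' ∈ D, θ z' = (1 / 2 * flagCurvature L z') • dJ L z') (ξ η : E × E) :
    dForm (horizontal (lagrangianSpray L)) θ z ξ η
      = 1 / 2 * (fderiv ℝ (flagCurvature L) z (ξ.1, connection (lagrangianSpray L) z ξ.1)
          * fderiv ℝ L z (0, η.1)
        - fderiv ℝ (flagCurvature L) z (η.1, connection (lagrangianSpray L) z η.1)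
          * fderiv ℝ L z (0, ξ.1)) := by
  have hS := h.isSemispray
  have h1 : θ =ᶠ[𝓝 z] fun z' => (1 / 2 * flagCurvature L z') • dJ L z' :=
    eventually_of_mem (h.isOpen.mem_nhds hz) hθ
  -- A semi-basic form is unchanged by `h`, which preserves the first component.
  have h2 : (fun z' => (θ z').comp (horizontal (lagrangianSpray L) z')) =ᶠ[𝓝 z]
      fun z' => (1 / 2 * flagCurvature L z') • dJ L z' :=
    eventually_of_mem (h.isOpen.mem_nhds hz) fun z' hz' => by
      refine ContinuousLinearMap.ext fun ζ => ?_
      rw [ContinuousLinearMap.comp_apply, hθ z' hz', hS.horizontal_apply hz', _root_.smul_apply,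
        _root_.smul_apply, dJ_apply, dJ_apply]
  simp only [dForm, extD, h1.fderiv_eq, h2.fderiv_eq, _root_.sub_apply,
    ContinuousLinearMap.flip_apply, h.fderiv_half_smul_dJ_apply hz hL, hS.horizontal_apply hz]
  have h3 := h.hessian_horizontal_symm hz ξ.1 η.1
  linear_combination (1 / 2 * flagCurvature L z) * h3

/-- The flag curvature is `c` if and only if `Φ = c F² J - c F d_J F ⊗ C`. -/
theorem jacobi_eq_iff {F : E × E → ℝ} (h : IsLagrangian (fun z => F z ^ 2) D)
    (hE : Module.finrank ℝ E = 2) (hz : z ∈ D) (hF : F z ≠ 0) (hd : DifferentiableAt ℝ F z)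
    (c : ℝ) :
    jacobi (geodesicSpray F) z = (c * F z ^ 2) • J
        - (c * F z) • (dJ F z).smulRight (liouville z)
      ↔ flagCurvature (fun z => F z ^ 2) z = c := by
  have : FiniteDimensional ℝ E := Module.finite_of_finrank_pos (by omega)
  have hL : F z ^ 2 ≠ 0 := pow_ne_zero 2 hF
  have hdL (u : E) : fderiv ℝ (fun z => F z ^ 2) z (0, u) = 2 * F z * fderiv ℝ F z (0, u) := by
    rw [fderiv_fun_pow _ hd]; simp
  have key : (c * F z ^ 2) • J - (c * F z) • (dJ F z).smulRight (liouville z)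
      = (c * F z ^ 2) • J
        - ((1 / 2 * c) • dJ (fun z => F z ^ 2) z).smulRight (liouville z) := by
    refine ContinuousLinearMap.ext fun ξ => ?_
    simp only [_root_.sub_apply, _root_.smul_apply, ContinuousLinearMap.smulRight_apply,
      dJ_apply, hdL, smul_eq_mul]
    module
  rw [geodesicSpray_eq, key]
  constructor
  · intro hj
    have h1 (u : E) : jacobiMatrix (lagrangianSpray fun z => F z ^ 2) z u = (c * F z ^ 2) • u
        - (1 / 2 * c * fderiv ℝ (fun z => F z ^ 2) z (0, u)) • z.2 := by
      have := congrArg (fun A => (A (u, 0)).2) hj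
      simpa [h.isSemispray.jacobi_apply hz, liouville, dJ_apply] using this
    obtain ⟨ℓ, hℓ⟩ := exists_verticalDerivative (fun z => F z ^ 2) z
    have hy : ℓ z.2 ≠ 0 := by rw [hℓ, h.euler z hz]; simpa using hF
    -- On a vector of `ker d_J L` both sides reduce to multiples of `J`, whose coefficients can be
    -- compared.
    obtain ⟨b, hb0, hb, -⟩ := exists_mem_ker_decomposition hE hy
    have h2 := h1 b
    rw [h.jacobiMatrix_eq hE hz hL, ← hℓ, hb, mul_zero, zero_smul, mul_zero, zero_smul, sub_zero,
      sub_zero] at h2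
    exact mul_right_cancel₀ hL (smul_left_injective ℝ hb0 h2)
  · rintro rfl
    rw [h.jacobi_eq hE hz hL, flagCurvature, div_mul_cancel₀ _ hL]

/-- If `W₁ = 0` and `d_h (½ κ d_J L) = 0` over a connected coordinate domain, then the flag
curvature is constant. -/
theorem exists_flagCurvature_eq {U : Set E} (h : IsLagrangian L (U ×ˢ {0}ᶜ))
    (hE : Module.finrank ℝ E = 2) (hU : IsOpen U) (hU' : IsPreconnected U)
    (hL : ∀ z ∈ U ×ˢ {0}ᶜ, L z ≠ 0)
    (hW : ∀ z ∈ U ×ˢ {0}ᶜ, ∀ ξ η, weylOne (lagrangianSpray L) z ξ η = 0)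
    {θ : E × E → E × E →L[ℝ] ℝ}
    (hθ : ∀ z ∈ U ×ˢ {0}ᶜ, θ z = (1 / 2 * flagCurvature L z) • dJ L z)
    (hc : ∀ z ∈ U ×ˢ {0}ᶜ, ∀ ξ η, dForm (horizontal (lagrangianSpray L)) θ z ξ η = 0) :
    ∃ c, ∀ z ∈ U ×ˢ {0}ᶜ, flagCurvature L z = c := by
  have : FiniteDimensional ℝ E := Module.finite_of_finrank_pos (by omega)
  have hconn : IsPreconnected ({0}ᶜ : Set E) :=
    (isConnected_compl_singleton_of_one_lt_rank
      (by rw [← Module.finrank_eq_rank, hE]; norm_num) 0).isPreconnected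
  have hdiff (z) (hz : z ∈ U ×ˢ ({0}ᶜ : Set E)) : DifferentiableAt ℝ (flagCurvature L) z :=
    (h.contDiffAt_flagCurvature hz (hL z hz)).differentiableAt (by simp)
  have hvert (z) (hz : z ∈ U ×ˢ ({0}ᶜ : Set E)) (u : E) :
      fderiv ℝ (flagCurvature L) z (0, u) = 0 :=
    (h.weylOne_eq_zero_iff hE hz (hL z hz)).1 (hW z hz) u
  have hfib (x) (hx : x ∈ U) (y y' : E) (hy : y ≠ 0) (hy' : y' ≠ 0) :
      flagCurvature L (x, y) = flagCurvature L (x, y') := by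
    have hd (v : E) (hv : v ≠ 0) :
        HasFDerivAt (fun v => flagCurvature L (x, v)) (0 : E →L[ℝ] ℝ) v := by
      have h1 : HasFDerivAt (fun v => flagCurvature L (x, v))
          ((fderiv ℝ (flagCurvature L) (x, v)).comp (ContinuousLinearMap.inr ℝ E E)) v :=
        HasFDerivAt.comp (g := flagCurvature L) (f := fun v => (x, v)) v
          (hdiff (x, v) ⟨hx, hv⟩).hasFDerivAt (hasFDerivAt_prodMk_right x v)
      have h2 : (fderiv ℝ (flagCurvature L) (x, v)).comp (ContinuousLinearMap.inr ℝ E E) = 0 :=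
        ContinuousLinearMap.ext fun u => hvert (x, v) ⟨hx, hv⟩ u
      rwa [h2] at h1
    exact isOpen_compl_singleton.is_const_of_fderiv_eq_zero (𝕜 := ℝ) hconn
      (fun v hv => (hd v hv).differentiableAt.differentiableWithinAt)
      (fun v hv => (hd v hv).fderiv) hy hy'
  have hhor (z) (hz : z ∈ U ×ˢ ({0}ᶜ : Set E)) (u : E) (y : E) (hy : y ≠ 0) :
      fderiv ℝ (flagCurvature L) z (u, 0) = fderiv ℝ (flagCurvature L) (z.1, y) (u, 0) := by
    have h1 (v : E) (hv : v ≠ 0) : HasFDerivAt (fun x => flagCurvature L (x, v))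
        ((fderiv ℝ (flagCurvature L) (z.1, v)).comp (ContinuousLinearMap.inl ℝ E E)) z.1 :=
      HasFDerivAt.comp (g := flagCurvature L) (f := fun x => (x, v)) z.1
        (hdiff (z.1, v) ⟨hz.1, hv⟩).hasFDerivAt (hasFDerivAt_prodMk_left z.1 v)
    -- Fibrewise constancy holds over all of the open set `U`, so it may be differentiated in `x`.
    have h2 : (fun x => flagCurvature L (x, z.2)) =ᶠ[𝓝 z.1] fun x => flagCurvature L (x, y) :=
      eventually_of_mem (hU.mem_nhds hz.1) fun x hx => hfib x hx _ _ hz.2 hy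
    have h3 := (h1 z.2 hz.2).unique ((h1 y hy).congr_of_eventuallyEq h2)
    exact congrArg (fun A => A u) h3
  have hzero (z) (hz : z ∈ U ×ˢ ({0}ᶜ : Set E)) : fderiv ℝ (flagCurvature L) z = 0 := by
    have hsplit (z') (hz' : z' ∈ U ×ˢ ({0}ᶜ : Set E)) (ξ : E × E) :
        fderiv ℝ (flagCurvature L) z' ξ = fderiv ℝ (flagCurvature L) z' (ξ.1, 0) := by
      have : ξ = (ξ.1, 0) + (0, ξ.2) := by simp
      conv_lhs => rw [this, map_add, hvert z' hz', add_zero]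
    -- A functional on a plane has a nonzero kernel vector. Using it both as the fibre coordinate
    -- and as the second argument of `d_h α` removes one term and turns the other into `L` times
    -- `dκ`.
    obtain ⟨y, hy, hy0⟩ : ∃ y : E, y ≠ 0 ∧ fderiv ℝ (flagCurvature L) z (y, 0) = 0 := by
      have h1 := LinearMap.ker_ne_bot_of_finrank_lt (K := ℝ)
        (f := ((fderiv ℝ (flagCurvature L) z).comp (ContinuousLinearMap.inl ℝ E E) : E →ₗ[ℝ] ℝ))
        (by rw [hE, Module.finrank_self]; norm_num)
      obtain ⟨y, hy, hy0⟩ := Submodule.exists_mem_ne_zero_of_ne_bot h1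
      exact ⟨y, hy0, hy⟩
    have hzy : (z.1, y) ∈ U ×ˢ ({0}ᶜ : Set E) := ⟨hz.1, hy⟩
    refine ContinuousLinearMap.ext fun ξ => ?_
    have h1 := hc (z.1, y) hzy ξ (y, 0)
    rw [h.dForm_horizontal_eq hzy (hL _ hzy) hθ, hsplit _ hzy (ξ.1, _), hsplit _ hzy ((y, (0 : E)).1, _),
      ← hhor z hz _ y hy, ← hhor z hz _ y hy, hy0, h.euler _ hzy] at h1
    rw [hsplit z hz]
    simpa [hL _ hzy] using h1
  exact (hU.prod isOpen_compl_singleton).exists_is_const_of_fderiv_eq_zero (𝕜 := ℝ)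
    (hU'.prod hconn) (fun z hz => (hdiff z hz).differentiableWithinAt) hzero

end IsLagrangian

end Surface

/-! ### Derivatives of related fields and endomorphisms under a smooth map. -/

section Naturality

variable {V : Type*} [NormedAddCommGroup V] [NormedSpace ℝ V]

theorem fderiv_comp_of_contDiffAt {G : Type*} [NormedAddCommGroup G] [NormedSpace ℝ G]
    {f : V → V} {g : V → G} {z : V} (hf : ContDiffAt ℝ ∞ f z) (hg : DifferentiableAt ℝ g (f z))
    (ξ : V) : fderiv ℝ (fun z' => g (f z')) z ξ = fderiv ℝ g (f z) (fderiv ℝ f z ξ) := by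
  have := fderiv_comp z hg (hf.differentiableAt (by simp))
  exact congrArg (fun A => A ξ) this

variable {f : V → V} {D : Set V} {z : V}

/-- The derivative of `z ↦ Df_z(X z)`. -/
theorem fderiv_fderiv_apply_field (hf : ContDiffAt ℝ ∞ f z) {X : V → V}
    (hX : DifferentiableAt ℝ X z) (ξ : V) :
    fderiv ℝ (fun z' => fderiv ℝ f z' (X z')) z ξ
      = fderiv ℝ (fderiv ℝ f) z ξ (X z) + fderiv ℝ f z (fderiv ℝ X z ξ) := by
  rw [fderiv_clm_apply ((hf.fderiv_right (m := ∞) (by simp)).differentiableAt (by simp)) hX]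
  simp [add_comm]

variable {X X' : V → V} {K K' : V → V →L[ℝ] V}

/-- The chain rule applied to `Df ∘ X = X' ∘ f`. The second derivative of `f` is kept explicit: its
symmetry is what cancels it from brackets in `lieD_related`. -/
theorem fderiv_of_related_field (hD : D ∈ 𝓝 z) (hf : ContDiffAt ℝ ∞ f z)
    (hX : DifferentiableAt ℝ X z) (hX' : DifferentiableAt ℝ X' (f z))
    (hXX' : ∀ z' ∈ D, fderiv ℝ f z' (X z') = X' (f z')) (ξ : V) :
    fderiv ℝ (fderiv ℝ f) z ξ (X z) + fderiv ℝ f z (fderiv ℝ X z ξ)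
      = fderiv ℝ X' (f z) (fderiv ℝ f z ξ) := by
  rw [← fderiv_fderiv_apply_field hf hX, ← fderiv_comp_of_contDiffAt hf hX']
  have h1 : (fun z' => fderiv ℝ f z' (X z')) =ᶠ[𝓝 z] fun z' => X' (f z') :=
    eventually_of_mem hD hXX'
  rw [h1.fderiv_eq]

theorem fderiv_of_related_endomorphism (hD : D ∈ 𝓝 z) (hf : ContDiffAt ℝ ∞ f z)
    (hK : DifferentiableAt ℝ K z) (hK' : DifferentiableAt ℝ K' (f z))
    (hKK' : ∀ z' ∈ D, ∀ ξ, fderiv ℝ f z' (K z' ξ) = K' (f z') (fderiv ℝ f z' ξ)) (ζ ξ : V) :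
    fderiv ℝ (fderiv ℝ f) z ζ (K z ξ) + fderiv ℝ f z (fderiv ℝ K z ζ ξ)
      = fderiv ℝ K' (f z) (fderiv ℝ f z ζ) (fderiv ℝ f z ξ)
        + K' (f z) (fderiv ℝ (fderiv ℝ f) z ζ ξ) := by
  have hf' : DifferentiableAt ℝ (fderiv ℝ f) z :=
    (hf.fderiv_right (m := ∞) (by simp)).differentiableAt (by simp)
  have hKξ : fderiv ℝ (fun z' => K z' ξ) z ζ = fderiv ℝ K z ζ ξ := by
    rw [fderiv_clm_apply hK (differentiableAt_const _)]; simp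
  have h1 : (fun z' => fderiv ℝ f z' (K z' ξ)) =ᶠ[𝓝 z]
      fun z' => K' (f z') (fderiv ℝ f z' ξ) := eventually_of_mem hD fun z' hz' => hKK' z' hz' ξ
  have h2 := congrArg (fun A => A ζ) (h1.fderiv_eq (𝕜 := ℝ))
  have hK'f : DifferentiableAt ℝ (fun z' => K' (f z')) z :=
    hK'.comp z (hf.differentiableAt (by simp))
  rw [fderiv_fderiv_apply_field hf (hK.clm_apply (differentiableAt_const _)), hKξ,
    fderiv_clm_apply hK'f
      (hf'.clm_apply (differentiableAt_const _))] at h2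
  rw [h2, ← fderiv_comp_of_contDiffAt hf hK', add_comm]
  simp only [_root_.add_apply, ContinuousLinearMap.comp_apply, ContinuousLinearMap.flip_apply]
  rw [fderiv_clm_apply hf' (differentiableAt_const _)]
  simp

end Naturality

/-! ### Invariance of the spray, its projectors, `Φ` and `κ` under changes of coordinates. -/

section NaturalityTangent

variable {E : Type*} [NormedAddCommGroup E] [NormedSpace ℝ E]
  {f : E × E → E × E} {D : Set (E × E)} {z : E × E}

/-- The exterior derivative commutes with pullbacks. -/
theorem extD_pullback (hD : D ∈ 𝓝 z) (hf : ContDiffAt ℝ ∞ f z)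
    {θ θ' : E × E → E × E →L[ℝ] ℝ} (hθ : DifferentiableAt ℝ θ z)
    (hθ' : DifferentiableAt ℝ θ' (f z))
    (hθθ' : ∀ z' ∈ D, ∀ ξ, θ z' ξ = θ' (f z') (fderiv ℝ f z' ξ)) (ξ η : E × E) :
    extD θ z ξ η = extD θ' (f z) (fderiv ℝ f z ξ) (fderiv ℝ f z η) := by
  have hf' : DifferentiableAt ℝ (fderiv ℝ f) z :=
    (hf.fderiv_right (m := ∞) (by simp)).differentiableAt (by simp)
  have key (ζ ξ : E × E) : fderiv ℝ θ z ζ ξ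
      = fderiv ℝ θ' (f z) (fderiv ℝ f z ζ) (fderiv ℝ f z ξ)
        + θ' (f z) (fderiv ℝ (fderiv ℝ f) z ζ ξ) := by
    have h1 : (fun z' => θ z' ξ) =ᶠ[𝓝 z] fun z' => θ' (f z') (fderiv ℝ f z' ξ) :=
      eventually_of_mem hD fun z' hz' => hθθ' z' hz' ξ
    have h2 := congrArg (fun A => A ζ) (h1.fderiv_eq (𝕜 := ℝ))
    have hθ'f : DifferentiableAt ℝ (fun z' => θ' (f z')) z :=
      hθ'.comp z (hf.differentiableAt (by simp))
    rw [fderiv_clm_apply hθ (differentiableAt_const _),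
      fderiv_clm_apply hθ'f
        (hf'.clm_apply (differentiableAt_const _)),
      fderiv_clm_apply hf' (differentiableAt_const _)] at h2
    rw [← fderiv_comp_of_contDiffAt hf hθ']
    simpa [add_comm] using h2
  -- The second derivative of `f` enters symmetrically and drops out of the antisymmetrization.
  have hs : IsSymmSndFDerivAt ℝ f z := hf.isSymmSndFDerivAt minSmoothness_two_le_infty
  simp only [extD, _root_.sub_apply, ContinuousLinearMap.flip_apply, key]
  rw [hs.eq ξ η]
  ring

/-- The Lie derivatives of related vector-valued 1-forms along related vector fields are related. -/
theorem lieD_related (hD : D ∈ 𝓝 z) (hf : ContDiffAt ℝ ∞ f z) {X X' : E × E → E × E}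
    {K K' : E × E → E × E →L[ℝ] E × E}
    (hX : DifferentiableAt ℝ X z) (hX' : DifferentiableAt ℝ X' (f z))
    (hK : DifferentiableAt ℝ K z) (hK' : DifferentiableAt ℝ K' (f z))
    (hXX' : ∀ z' ∈ D, fderiv ℝ f z' (X z') = X' (f z'))
    (hKK' : ∀ z' ∈ D, ∀ ξ, fderiv ℝ f z' (K z' ξ) = K' (f z') (fderiv ℝ f z' ξ)) (ξ : E × E) :
    fderiv ℝ f z (lieD X K z ξ) = lieD X' K' (f z) (fderiv ℝ f z ξ) := by
  have hz : z ∈ D := mem_of_mem_nhds hD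
  have hs : IsSymmSndFDerivAt ℝ f z := hf.isSymmSndFDerivAt minSmoothness_two_le_infty
  have h1 := fderiv_of_related_endomorphism hD hf hK hK' hKK' (X z) ξ
  have h2 := fderiv_of_related_field hD hf hX hX' hXX' ξ
  have h3 := fderiv_of_related_field hD hf hX hX' hXX' (K z ξ)
  rw [hXX' z hz, hs.eq (X z)] at h1
  rw [hKK' z hz] at h3
  rw [hs.eq (X z)] at h1
  simp only [lieD, _root_.add_apply, _root_.sub_apply, ContinuousLinearMap.comp_apply, map_add,
    map_sub, hKK' z hz, ← h2, ← h3]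
  rw [eq_sub_of_add_eq' h1]
  abel

/-- The map induced on tangent vectors by a change of coordinates. -/
def tangentTransition (τ : E → E) (z : E × E) : E × E := (τ z.1, fderiv ℝ τ z.1 z.2)

variable {τ : E → E}

theorem contDiffAt_tangentTransition (hτ : ContDiffAt ℝ ∞ τ z.1) :
    ContDiffAt ℝ ∞ (tangentTransition τ) z := by
  have h1 : ContDiffAt ℝ ∞ (fun z' : E × E => τ z'.1) z := hτ.comp z contDiffAt_fst
  have h2 : ContDiffAt ℝ ∞ (fun z' : E × E => fderiv ℝ τ z'.1) z :=
    (hτ.fderiv_right (m := ∞) (by simp)).comp z contDiffAt_fst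
  exact h1.prodMk (h2.clm_apply contDiffAt_snd)

theorem fderiv_tangentTransition_apply (hτ : ContDiffAt ℝ ∞ τ z.1) (ξ : E × E) :
    fderiv ℝ (tangentTransition τ) z ξ = (fderiv ℝ τ z.1 ξ.1,
      fderiv ℝ (fderiv ℝ τ) z.1 ξ.1 z.2 + fderiv ℝ τ z.1 ξ.2) := by
  have h1 : HasFDerivAt (fun z' : E × E => τ z'.1)
      ((fderiv ℝ τ z.1).comp (ContinuousLinearMap.fst ℝ E E)) z :=
    HasFDerivAt.comp z (hτ.differentiableAt (by simp)).hasFDerivAt hasFDerivAt_fst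
  have h2 : HasFDerivAt (fun z' : E × E => fderiv ℝ τ z'.1)
      ((fderiv ℝ (fderiv ℝ τ) z.1).comp (ContinuousLinearMap.fst ℝ E E)) z :=
    HasFDerivAt.comp z ((hτ.fderiv_right (m := ∞) (by simp)).differentiableAt
      (by simp)).hasFDerivAt hasFDerivAt_fst
  have h3 := h1.prodMk (h2.clm_apply hasFDerivAt_snd)
  rw [show tangentTransition τ = fun z' => (τ z'.1, fderiv ℝ τ z'.1 z'.2) from rfl, h3.fderiv]
  simp [add_comm]

theorem fderiv_tangentTransition_J (hτ : ContDiffAt ℝ ∞ τ z.1) (ξ : E × E) :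
    fderiv ℝ (tangentTransition τ) z (J ξ) = J (fderiv ℝ (tangentTransition τ) z ξ) := by
  simp [fderiv_tangentTransition_apply hτ]

theorem fderiv_tangentTransition_surjective (hτ : ContDiffAt ℝ ∞ τ z.1)
    (hs : Function.Surjective (fderiv ℝ τ z.1)) :
    Function.Surjective (fderiv ℝ (tangentTransition τ) z) := by
  rintro ⟨u', w'⟩
  obtain ⟨u, rfl⟩ := hs u'
  obtain ⟨w, hw⟩ := hs (w' - fderiv ℝ (fderiv ℝ τ) z.1 u z.2)
  exact ⟨(u, w), by simp [fderiv_tangentTransition_apply hτ, hw]⟩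

/-- A change of coordinates `τ` between two Lagrangians. -/
structure IsLagrangianMap (τ : E → E) (L L' : E × E → ℝ) (D D' : Set (E × E)) : Prop where
  source : IsLagrangian L D
  target : IsLagrangian L' D'
  smooth : ∀ z ∈ D, ContDiffAt ℝ ∞ τ z.1
  surjective : ∀ z ∈ D, Function.Surjective (fderiv ℝ τ z.1)
  mapsTo : MapsTo (tangentTransition τ) D D'
  eq : ∀ z ∈ D, L z = L' (tangentTransition τ z)

namespace IsLagrangianMap

variable {L L' : E × E → ℝ} {D' : Set (E × E)}

theorem fderiv_eq (h : IsLagrangianMap τ L L' D D') (hz : z ∈ D) (ξ : E × E) :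
    fderiv ℝ L z ξ
      = fderiv ℝ L' (tangentTransition τ z) (fderiv ℝ (tangentTransition τ) z ξ) := by
  have h1 : L =ᶠ[𝓝 z] fun z' => L' (tangentTransition τ z') :=
    eventually_of_mem (h.source.isOpen.mem_nhds hz) h.eq
  rw [h1.fderiv_eq, fderiv_comp_of_contDiffAt (contDiffAt_tangentTransition (h.smooth z hz))
    (h.target.differentiableAt (h.mapsTo hz))]

theorem dJ_eq (h : IsLagrangianMap τ L L' D D') (hz : z ∈ D) (ξ : E × E) :
    dJ L z ξ = dJ L' (tangentTransition τ z) (fderiv ℝ (tangentTransition τ) z ξ) := by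
  rw [dJ, ContinuousLinearMap.comp_apply, h.fderiv_eq hz,
    fderiv_tangentTransition_J (h.smooth z hz)]
  rfl

variable [FiniteDimensional ℝ E]

/-- The pushed-forward spray solves the equation defining the spray of `L'`, because `d d_J L` is
the pullback of `d d_J L'`; the solution is unique. -/
theorem spray_related (h : IsLagrangianMap τ L L' D D') (hz : z ∈ D) :
    fderiv ℝ (tangentTransition τ) z (lagrangianSpray L z)
      = lagrangianSpray L' (tangentTransition τ z) := by
  apply h.target.extD_dJ_injective (h.mapsTo hz)
  rw [h.target.extD_spray (h.mapsTo hz)]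
  refine ContinuousLinearMap.ext fun η' => ?_
  obtain ⟨η, rfl⟩ := fderiv_tangentTransition_surjective (h.smooth z hz) (h.surjective z hz) η'
  rw [← extD_pullback (h.source.isOpen.mem_nhds hz)
    (contDiffAt_tangentTransition (h.smooth z hz))
    ((h.source.contDiffAt_dJ hz).differentiableAt (by simp))
    ((h.target.contDiffAt_dJ (h.mapsTo hz)).differentiableAt (by simp))
    (fun z' hz' ξ => h.dJ_eq hz' ξ), h.source.extD_spray hz]
  simp [h.fderiv_eq hz]

theorem lieD_J_related (h : IsLagrangianMap τ L L' D D') (hz : z ∈ D) (ξ : E × E) :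
    fderiv ℝ (tangentTransition τ) z (lieD (lagrangianSpray L) (fun _ => J) z ξ)
      = lieD (lagrangianSpray L') (fun _ => J) (tangentTransition τ z)
        (fderiv ℝ (tangentTransition τ) z ξ) :=
  lieD_related (h.source.isOpen.mem_nhds hz) (contDiffAt_tangentTransition (h.smooth z hz))
    (h.source.isSemispray.differentiableAt hz)
    (h.target.isSemispray.differentiableAt (h.mapsTo hz))
    (differentiableAt_const _) (differentiableAt_const _)
    (fun _ hz' => h.spray_related hz')
    (fun z' hz' ξ => fderiv_tangentTransition_J (h.smooth z' hz') ξ) ξ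

theorem horizontal_related (h : IsLagrangianMap τ L L' D D') (hz : z ∈ D) (ξ : E × E) :
    fderiv ℝ (tangentTransition τ) z (horizontal (lagrangianSpray L) z ξ)
      = horizontal (lagrangianSpray L') (tangentTransition τ z)
        (fderiv ℝ (tangentTransition τ) z ξ) := by
  simp [horizontal, h.lieD_J_related hz]

theorem vertical_related (h : IsLagrangianMap τ L L' D D') (hz : z ∈ D) (ξ : E × E) :
    fderiv ℝ (tangentTransition τ) z (vertical (lagrangianSpray L) z ξ)
      = vertical (lagrangianSpray L') (tangentTransition τ z)
        (fderiv ℝ (tangentTransition τ) z ξ) := by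
  simp [vertical, h.lieD_J_related hz]

theorem jacobi_related (h : IsLagrangianMap τ L L' D D') (hz : z ∈ D) (ξ : E × E) :
    fderiv ℝ (tangentTransition τ) z (jacobi (lagrangianSpray L) z ξ)
      = jacobi (lagrangianSpray L') (tangentTransition τ z)
        (fderiv ℝ (tangentTransition τ) z ξ) := by
  rw [jacobi, jacobi, ContinuousLinearMap.comp_apply, ContinuousLinearMap.comp_apply,
    h.vertical_related hz]
  congr 1
  exact lieD_related (h.source.isOpen.mem_nhds hz)
    (contDiffAt_tangentTransition (h.smooth z hz))
    (h.source.isSemispray.differentiableAt hz)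
    (h.target.isSemispray.differentiableAt (h.mapsTo hz))
    ((h.source.isSemispray.contDiffAt_horizontal hz).differentiableAt (by simp))
    ((h.target.isSemispray.contDiffAt_horizontal (h.mapsTo hz)).differentiableAt (by simp))
    (fun _ hz' => h.spray_related hz') (fun _ hz' ξ => h.horizontal_related hz' ξ) ξ

/-- The flag curvature does not depend on the coordinates. -/
theorem flagCurvature_eq (h : IsLagrangianMap τ L L' D D') (hE : Module.finrank ℝ E = 2)
    (hz : z ∈ D) (hL : L z ≠ 0) :
    flagCurvature L z = flagCurvature L' (tangentTransition τ z) := by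
  have hz' := h.mapsTo hz
  have hτ := h.smooth z hz
  have hL' : L' (tangentTransition τ z) ≠ 0 := h.eq z hz ▸ hL
  obtain ⟨ℓ, hℓ⟩ := IsLagrangian.exists_verticalDerivative L' (tangentTransition τ z)
  have hy : ℓ (tangentTransition τ z).2 ≠ 0 := by
    rw [hℓ, h.target.euler _ hz']; simpa using hL'
  -- On a lift of `b ∈ ker d_J L'` both Jacobi endomorphisms act as `ρ J`. Comparing them there
  -- yields the invariance of `ρ` without transforming a trace.
  obtain ⟨b, hb0, hb, -⟩ := exists_mem_ker_decomposition hE hy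
  obtain ⟨ξ, hξ⟩ := fderiv_tangentTransition_surjective hτ (h.surjective z hz) (b, 0)
  have h1 := h.jacobi_related hz ξ
  rw [h.source.jacobi_eq hE hz hL, h.target.jacobi_eq hE hz' hL'] at h1
  simp only [_root_.sub_apply, _root_.smul_apply, ContinuousLinearMap.smulRight_apply, map_sub,
    map_smul, fderiv_tangentTransition_J hτ, h.dJ_eq hz, hξ] at h1
  have h2 : dJ L' (tangentTransition τ z) (b, 0) = 0 := (hℓ b).symm.trans hb
  rw [h2, smul_zero, smul_zero, zero_smul, zero_smul, sub_zero, sub_zero, J_apply, Prod.smul_mk,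
    Prod.smul_mk, Prod.mk.injEq] at h1
  have h3 : ricci (lagrangianSpray L) z = ricci (lagrangianSpray L') (tangentTransition τ z) :=
    smul_left_injective ℝ hb0 h1.2
  rw [flagCurvature, flagCurvature, h3, h.eq z hz]

end IsLagrangianMap

end NaturalityTangent

/-! ### Induced charts of the tangent bundle and their transitions. -/

section Charts

theorem contMDiff_tangentVector {E : Type*} [NormedAddCommGroup E] [NormedSpace ℝ E] :
    ContMDiff 𝓘(ℝ, E × E) 𝓘(ℝ, E).tangent ∞
      (fun z : E × E => (⟨z.1, z.2⟩ : TangentBundle 𝓘(ℝ, E) E)) := by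
  have h := contMDiff_tangentBundleModelSpaceHomeomorph_symm (I := 𝓘(ℝ, E)) (n := ∞)
  rw [modelWithCornersSelf_prod]
  exact h

theorem isOpen_slit {E M : Type*} [NormedAddCommGroup E] [TopologicalSpace M]
    (φ : OpenPartialHomeomorph M E) : IsOpen (slit φ) :=
  φ.open_target.prod isOpen_compl_singleton

variable {E : Type*} [NormedAddCommGroup E] [NormedSpace ℝ E]
  {M : Type*} [TopologicalSpace M] [ChartedSpace E M]

/-- All tangent spaces are definitionally the model space `E`, so vectors at propositionally equal
points can be compared without transport. -/
theorem tangentBundle_mk_eq {x x' : M} (hx : x = x') {v v' : E} (hv : v = v') :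
    (⟨x, v⟩ : TangentBundle 𝓘(ℝ, E) M) = ⟨x', v'⟩ := by
  subst hx hv; rfl

theorem mdifferentiable_of_mem_maximalAtlas {φ : OpenPartialHomeomorph M E}
    (hφ : φ ∈ IsManifold.maximalAtlas 𝓘(ℝ, E) ∞ M) :
    φ.MDifferentiable 𝓘(ℝ, E) 𝓘(ℝ, E) :=
  ⟨(contMDiffOn_of_mem_maximalAtlas hφ).mdifferentiableOn (by simp),
    (contMDiffOn_symm_of_mem_maximalAtlas hφ).mdifferentiableOn (by simp)⟩

variable {φ ψ : OpenPartialHomeomorph M E}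

theorem mfderiv_symm_injective (hφ : φ ∈ IsManifold.maximalAtlas 𝓘(ℝ, E) ∞ M) {x : E}
    (hx : x ∈ φ.target) : Function.Injective (mfderiv 𝓘(ℝ, E) 𝓘(ℝ, E) φ.symm x) :=
  (mdifferentiable_of_mem_maximalAtlas hφ).symm.mfderiv_injective hx

/-- The coordinates of a tangent vector induced by a chart. -/
def tangentCoord (φ : OpenPartialHomeomorph M E) (p : TangentBundle 𝓘(ℝ, E) M) : E × E :=
  (φ p.1, mfderiv 𝓘(ℝ, E) 𝓘(ℝ, E) φ p.1 p.2)

theorem lift_tangentCoord (hφ : φ ∈ IsManifold.maximalAtlas 𝓘(ℝ, E) ∞ M)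
    {p : TangentBundle 𝓘(ℝ, E) M} (hp : p.1 ∈ φ.source) : lift φ (tangentCoord φ p) = p :=
  tangentBundle_mk_eq (φ.left_inv hp) (congrArg (fun A : E →L[ℝ] E => A p.2)
    ((mdifferentiable_of_mem_maximalAtlas hφ).symm_comp_deriv hp))

theorem tangentCoord_mem_slit (hφ : φ ∈ IsManifold.maximalAtlas 𝓘(ℝ, E) ∞ M)
    {p : TangentBundle 𝓘(ℝ, E) M} (hp : p.1 ∈ φ.source) (hp' : p.2 ≠ 0) :
    tangentCoord φ p ∈ slit φ :=
  ⟨φ.map_source hp, fun h0 => hp'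
    ((mdifferentiable_of_mem_maximalAtlas hφ).mfderiv_injective hp (h0.trans (map_zero _).symm))⟩

theorem lift_injOn (hφ : φ ∈ IsManifold.maximalAtlas 𝓘(ℝ, E) ∞ M) {z z' : E × E}
    (hz : z.1 ∈ φ.target) (hz' : z'.1 ∈ φ.target) (h : lift φ z = lift φ z') : z = z' := by
  obtain ⟨x, y⟩ := z
  obtain ⟨x', y'⟩ := z'
  have hx : x = x' := φ.symm.injOn hz hz' (congrArg TotalSpace.proj h)
  subst hx
  have hy : y = y' := mfderiv_symm_injective hφ hz (TotalSpace.mk_inj.1 h)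
  rw [hy]

/-- The chain rule for `ψ⁻¹ ∘ (ψ ∘ φ⁻¹) = φ⁻¹`. -/
theorem lift_tangentTransition (hφ : φ ∈ IsManifold.maximalAtlas 𝓘(ℝ, E) ∞ M)
    (hψ : ψ ∈ IsManifold.maximalAtlas 𝓘(ℝ, E) ∞ M) {z : E × E}
    (hz : z.1 ∈ (φ.symm.trans ψ).source) :
    lift ψ (tangentTransition (φ.symm.trans ψ) z) = lift φ z := by
  have hd := ((mdifferentiable_of_mem_maximalAtlas hφ).symm.trans
    (mdifferentiable_of_mem_maximalAtlas hψ)).mdifferentiableAt hz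
  have hd' := (mdifferentiable_of_mem_maximalAtlas hψ).mdifferentiableAt_symm
    ((φ.symm.trans ψ).map_source hz).1
  have hev : ψ.symm ∘ (φ.symm.trans ψ) =ᶠ[𝓝 z.1] φ.symm :=
    eventually_of_mem ((φ.symm.trans ψ).open_source.mem_nhds hz) fun x hx => ψ.left_inv hx.2
  refine tangentBundle_mk_eq hev.eq_of_nhds ?_
  have h1 := mfderiv_comp z.1 hd' hd
  rw [hev.mfderiv_eq, mfderiv_eq_fderiv] at h1
  exact (congrArg (fun A : E →L[ℝ] E => A z.2) h1).symm

theorem lift_snd_ne_zero (hφ : φ ∈ IsManifold.maximalAtlas 𝓘(ℝ, E) ∞ M) {z : E × E}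
    (hz : z ∈ slit φ) : (lift φ z).2 ≠ 0 := fun h =>
  hz.2 (mfderiv_symm_injective hφ hz.1 (h.trans (map_zero _).symm))

theorem inChart_fibre_fderiv (hφ : φ ∈ IsManifold.maximalAtlas 𝓘(ℝ, E) ∞ M) {z : E × E}
    (hz : z ∈ slit φ) (G : TangentBundle 𝓘(ℝ, E) M → ℝ) (u : E) :
    fderiv ℝ (fun y => inChart G φ (z.1, y)) z.2 u
      = fderiv ℝ (fun v : E => G ⟨φ.symm z.1, v⟩) (lift φ z).2
        (mfderiv 𝓘(ℝ, E) 𝓘(ℝ, E) φ.symm z.1 u) := by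
  let A : E ≃L[ℝ] E := (mdifferentiable_of_mem_maximalAtlas hφ).symm.mfderiv hz.1
  have h1 := A.comp_right_fderiv (f := fun v : E => G ⟨φ.symm z.1, v⟩) (x := z.2)
  exact congrArg (fun B => B u) h1

/-- `lift φ` is the tangent map of `φ.symm` after identifying `E × E` with the tangent bundle of
`E`. -/
theorem contMDiffOn_lift [IsManifold 𝓘(ℝ, E) ∞ M]
    (hφ : φ ∈ IsManifold.maximalAtlas 𝓘(ℝ, E) ∞ M) :
    ContMDiffOn 𝓘(ℝ, E × E) 𝓘(ℝ, E).tangent ∞ (lift φ) (Prod.fst ⁻¹' φ.target) := by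
  have h1 := (contMDiffOn_symm_of_mem_maximalAtlas hφ).contMDiffOn_tangentMapWithin (m := ∞)
    (by simp) φ.open_target.uniqueMDiffOn
  refine (h1.comp contMDiff_tangentVector.contMDiffOn (s := Prod.fst ⁻¹' φ.target)
    fun z hz => hz).congr fun z hz => ?_
  simp only [Function.comp, tangentMapWithin]
  rw [mfderivWithin_of_isOpen φ.open_target hz]
  rfl

end Charts

/-! ### From charts to the manifold: the global function `κ`, the form `α`, and the equivalence. -/

section FinslerFunction

variable {E : Type*} [NormedAddCommGroup E] [NormedSpace ℝ E]
  {M : Type*} [TopologicalSpace M] [ChartedSpace E M] [IsManifold 𝓘(ℝ, E) ∞ M]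
  {F : TangentBundle 𝓘(ℝ, E) M → ℝ} {φ ψ : OpenPartialHomeomorph M E}

namespace IsFinsler

theorem contDiffOn_inChart (hF : IsFinsler F)
    (hφ : φ ∈ IsManifold.maximalAtlas 𝓘(ℝ, E) ∞ M) : ContDiffOn ℝ ∞ (inChart F φ) (slit φ) := by
  rw [← contMDiffOn_iff_contDiffOn]
  exact hF.smooth.comp ((contMDiffOn_lift hφ).mono fun z hz => hz.1)
    fun z hz => lift_snd_ne_zero hφ hz

theorem contDiffAt_inChart (hF : IsFinsler F)
    (hφ : φ ∈ IsManifold.maximalAtlas 𝓘(ℝ, E) ∞ M) {z : E × E} (hz : z ∈ slit φ) :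
    ContDiffAt ℝ ∞ (inChart F φ) z :=
  (hF.contDiffOn_inChart hφ).contDiffAt ((isOpen_slit φ).mem_nhds hz)

theorem inChart_pos (hF : IsFinsler F) (hφ : φ ∈ IsManifold.maximalAtlas 𝓘(ℝ, E) ∞ M)
    {z : E × E} (hz : z ∈ slit φ) : 0 < inChart F φ z :=
  hF.pos _ (lift_snd_ne_zero hφ hz)

theorem inChart_smul (hF : IsFinsler F) (z : E × E) {c : ℝ} (hc : 0 < c) :
    inChart F φ (z.1, c • z.2) = c * inChart F φ z := by
  have h1 : lift φ (z.1, c • z.2) = ⟨(lift φ z).1, c • (lift φ z).2⟩ :=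
    tangentBundle_mk_eq rfl (map_smul (mfderiv 𝓘(ℝ, E) 𝓘(ℝ, E) φ.symm z.1) c z.2)
  rw [inChart, h1]
  exact hF.homogeneous _ _ c hc

/-- Euler's identity is the derivative at `t = 1` of `F²(x, t y) = t² F²(x, y)`. Regularity
transfers because the metric is half the vertical block of the full Hessian of `F²`. -/
theorem isLagrangian (hF : IsFinsler F) (hφ : φ ∈ IsManifold.maximalAtlas 𝓘(ℝ, E) ∞ M) :
    IsLagrangian (fun z => inChart F φ z ^ 2) (slit φ) := by
  have hs (z) (hz : z ∈ slit φ) : ContDiffAt ℝ ∞ (fun z => inChart F φ z ^ 2) z :=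
    (hF.contDiffAt_inChart hφ hz).pow 2
  have hd (z) (hz : z ∈ slit φ) : DifferentiableAt ℝ (fun z => inChart F φ z ^ 2) z :=
    (hs z hz).differentiableAt (by simp)
  refine ⟨isOpen_slit φ, fun z hz => (hs z hz).contDiffWithinAt, fun z hz => ?_,
    fun z hz u hu => hF.nondegenerate φ hφ z hz u fun w => ?_⟩
  · have h1 : HasDerivAt (fun t : ℝ => ((z.1, t • z.2) : E × E)) (0, z.2) 1 := by
      have := (hasDerivAt_id (1 : ℝ)).smul_const z.2
      rw [one_smul] at this
      exact (hasDerivAt_const (1 : ℝ) z.1).prodMk this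
    have h2 : HasDerivAt (fun t : ℝ => inChart F φ (z.1, t • z.2) ^ 2)
        (fderiv ℝ (fun z => inChart F φ z ^ 2) z (0, z.2)) 1 := by
      refine HasFDerivAt.comp_hasDerivAt (l := fun z => inChart F φ z ^ 2) 1 ?_ h1
      rw [one_smul]
      exact (hd z hz).hasFDerivAt
    have h3 : HasDerivAt (fun t : ℝ => t ^ 2 * inChart F φ z ^ 2)
        (2 * inChart F φ z ^ 2) 1 := by
      simpa using (hasDerivAt_pow 2 (1 : ℝ)).mul_const (inChart F φ z ^ 2)
    refine h2.unique (h3.congr_of_eventuallyEq ?_)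
    filter_upwards [lt_mem_nhds one_pos] with t ht
    rw [hF.inChart_smul z ht, mul_pow]
  · have h1 : fderiv ℝ (fun y => inChart F φ (z.1, y) ^ 2) =ᶠ[𝓝 z.2] fun y =>
        (fderiv ℝ (fun z => inChart F φ z ^ 2) (z.1, y)).comp
          (ContinuousLinearMap.inr ℝ E E) :=
      eventually_of_mem (isOpen_compl_singleton.mem_nhds hz.2) fun y hy =>
        (HasFDerivAt.comp (g := fun z => inChart F φ z ^ 2) y (hd (z.1, y) ⟨hz.1, hy⟩).hasFDerivAt
          (hasFDerivAt_prodMk_right z.1 y)).fderiv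
    have h2 : DifferentiableAt ℝ (fderiv ℝ fun z => inChart F φ z ^ 2) z :=
      ((hs z hz).fderiv_right (m := ∞) (by simp)).differentiableAt (by simp)
    have h3 : HasFDerivAt (fun y => fderiv ℝ (fun z => inChart F φ z ^ 2) (z.1, y))
        ((fderiv ℝ (fderiv ℝ fun z => inChart F φ z ^ 2) z).comp
          (ContinuousLinearMap.inr ℝ E E)) z.2 :=
      HasFDerivAt.comp (g := fderiv ℝ fun z => inChart F φ z ^ 2) z.2 h2.hasFDerivAt
        (hasFDerivAt_prodMk_right z.1 z.2)
    have h4 := (h3.clm_comp (hasFDerivAt_const (ContinuousLinearMap.inr ℝ E E) z.2)).fderiv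
    have hsym : IsSymmSndFDerivAt ℝ (fun z => inChart F φ z ^ 2) z :=
      (hs z hz).isSymmSndFDerivAt minSmoothness_two_le_infty
    have h5 := hu w
    rw [hsym.eq] at h5
    rw [metric, h1.fderiv_eq, h4]
    simpa using h5

theorem isLagrangianMap (hF : IsFinsler F) (hφ : φ ∈ IsManifold.maximalAtlas 𝓘(ℝ, E) ∞ M)
    (hψ : ψ ∈ IsManifold.maximalAtlas 𝓘(ℝ, E) ∞ M) :
    IsLagrangianMap (φ.symm.trans ψ) (fun z => inChart F φ z ^ 2) (fun z => inChart F ψ z ^ 2)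
      ((φ.symm.trans ψ).source ×ˢ {0}ᶜ) (slit ψ) := by
  have hm := (mdifferentiable_of_mem_maximalAtlas hφ).symm.trans
    (mdifferentiable_of_mem_maximalAtlas hψ)
  refine ⟨(hF.isLagrangian hφ).mono
      ((φ.symm.trans ψ).open_source.prod isOpen_compl_singleton) fun z hz => ⟨hz.1.1, hz.2⟩,
    hF.isLagrangian hψ, fun z hz => ?_, fun z hz => ?_, fun z hz => ⟨?_, fun h0 => hz.2 ?_⟩,
    fun z hz => ?_⟩
  · refine ContDiffOn.contDiffAt (s := (φ.symm.trans ψ).source) ?_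
      ((φ.symm.trans ψ).open_source.mem_nhds hz.1)
    rw [← contMDiffOn_iff_contDiffOn]
    exact (contMDiffOn_of_mem_maximalAtlas hψ).comp
      ((contMDiffOn_symm_of_mem_maximalAtlas hφ).mono fun x hx => hx.1) fun x hx => hx.2
  · rw [← mfderiv_eq_fderiv]
    exact hm.mfderiv_surjective hz.1
  · exact ((φ.symm.trans ψ).map_source hz.1).1
  · have h1 := hm.mfderiv_injective hz.1
    rw [mfderiv_eq_fderiv] at h1
    exact h1 (h0.trans (map_zero _).symm)
  · simp only [inChart]
    rw [lift_tangentTransition hφ hψ hz.1]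

variable [FiniteDimensional ℝ E]

theorem flagCurvature_eq_of_lift_eq (hF : IsFinsler F) (hE : Module.finrank ℝ E = 2)
    (hφ : φ ∈ IsManifold.maximalAtlas 𝓘(ℝ, E) ∞ M)
    (hψ : ψ ∈ IsManifold.maximalAtlas 𝓘(ℝ, E) ∞ M) {z z' : E × E} (hz : z ∈ slit φ)
    (hz' : z' ∈ slit ψ) (h : lift φ z = lift ψ z') :
    flagCurvature (fun z => inChart F φ z ^ 2) z
      = flagCurvature (fun z => inChart F ψ z ^ 2) z' := by
  have hx : z.1 ∈ (φ.symm.trans ψ).source := by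
    refine ⟨hz.1, ?_⟩
    have h1 : φ.symm z.1 = ψ.symm z'.1 := congrArg TotalSpace.proj h
    change φ.symm z.1 ∈ ψ.source
    rw [h1]
    exact ψ.map_target hz'.1
  have h2 : tangentTransition (φ.symm.trans ψ) z = z' :=
    lift_injOn hψ ((φ.symm.trans ψ).map_source hx).1 hz'.1
      ((lift_tangentTransition hφ hψ hx).trans h)
  rw [← h2]
  exact (hF.isLagrangianMap hφ hψ).flagCurvature_eq hE ⟨hx, hz.2⟩
    (pow_ne_zero 2 (hF.inChart_pos hφ hz).ne')

end IsFinsler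

/-- The flag curvature of a Finsler surface, as a function on the tangent bundle. -/
def tangentFlagCurvature (F : TangentBundle 𝓘(ℝ, E) M → ℝ) (p : TangentBundle 𝓘(ℝ, E) M) : ℝ :=
  flagCurvature (fun z => inChart F (chartAt E p.1) z ^ 2) (tangentCoord (chartAt E p.1) p)

theorem IsFinsler.tangentFlagCurvature_lift [FiniteDimensional ℝ E] (hF : IsFinsler F)
    (hE : Module.finrank ℝ E = 2) (hφ : φ ∈ IsManifold.maximalAtlas 𝓘(ℝ, E) ∞ M) {z : E × E}
    (hz : z ∈ slit φ) :
    tangentFlagCurvature F (lift φ z) = flagCurvature (fun z => inChart F φ z ^ 2) z := by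
  have hψ := IsManifold.chart_mem_maximalAtlas (I := 𝓘(ℝ, E)) (n := ∞) (lift φ z).1
  have hx := mem_chart_source E (lift φ z).1
  exact hF.flagCurvature_eq_of_lift_eq hE hψ hφ
    (tangentCoord_mem_slit hψ hx (lift_snd_ne_zero hφ hz)) hz (lift_tangentCoord hψ hx)

/-- The semi-basic form `½ κ d_J F²`, where `κ` is the flag curvature. -/
def isotropicForm (F : TangentBundle 𝓘(ℝ, E) M → ℝ) : SemiBasic E M := fun p =>
  ((1 / 2 * tangentFlagCurvature F p) • fderiv ℝ (fun v : E => F ⟨p.1, v⟩ ^ 2) p.2 : E →L[ℝ] ℝ)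

namespace IsFinsler

theorem localForm_isotropicForm [FiniteDimensional ℝ E] (hF : IsFinsler F)
    (hE : Module.finrank ℝ E = 2) (hφ : φ ∈ IsManifold.maximalAtlas 𝓘(ℝ, E) ∞ M) {z : E × E}
    (hz : z ∈ slit φ) :
    localForm (isotropicForm F) φ z = (1 / 2 * flagCurvature (fun z => inChart F φ z ^ 2) z) •
      dJ (fun z => inChart F φ z ^ 2) z := by
  refine ContinuousLinearMap.ext fun ξ => ?_
  have h1 := inChart_fibre_fderiv hφ hz (fun p => F p ^ 2) ξ.1
  have h2 : HasFDerivAt (fun y => inChart F φ (z.1, y) ^ 2)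
      ((fderiv ℝ (fun z => inChart F φ z ^ 2) z).comp (ContinuousLinearMap.inr ℝ E E)) z.2 :=
    HasFDerivAt.comp (g := fun z => inChart F φ z ^ 2) z.2
      ((hF.isLagrangian hφ).differentiableAt hz).hasFDerivAt (hasFDerivAt_prodMk_right z.1 z.2)
  have h3 : fderiv ℝ (fun y => inChart (fun p => F p ^ 2) φ (z.1, y)) z.2 ξ.1
      = dJ (fun z => inChart F φ z ^ 2) z ξ := congrArg (fun B => B ξ.1) h2.fderiv
  rw [_root_.smul_apply, ← h3, h1, ← hF.tangentFlagCurvature_lift hE hφ hz]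
  rfl

theorem isIsotropicForm_isotropicForm (hF : IsFinsler F) (hE : Module.finrank ℝ E = 2) :
    IsIsotropicForm F (isotropicForm F) := by
  have : FiniteDimensional ℝ E := Module.finite_of_finrank_pos (by omega)
  refine ⟨fun φ hφ => ContDiffOn.congr (fun z hz => ?_)
    fun z hz => hF.localForm_isotropicForm hE hφ hz, fun φ hφ z hz => ?_⟩
  · have h := hF.isLagrangian hφ
    exact ((contDiffAt_const.mul (h.contDiffAt_flagCurvature hz
      (pow_ne_zero 2 (hF.inChart_pos hφ hz).ne'))).smul (h.contDiffAt_dJ hz)).contDiffWithinAt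
  · rw [hF.localForm_isotropicForm hE hφ hz]
    exact (hF.isLagrangian hφ).jacobi_eq hE hz (pow_ne_zero 2 (hF.inChart_pos hφ hz).ne')

theorem localForm_eq (hF : IsFinsler F) (hE : Module.finrank ℝ E = 2) {α : SemiBasic E M}
    (hα : IsIsotropicForm F α) (hφ : φ ∈ IsManifold.maximalAtlas 𝓘(ℝ, E) ∞ M) {z : E × E}
    (hz : z ∈ slit φ) :
    localForm α φ z = (1 / 2 * flagCurvature (fun z => inChart F φ z ^ 2) z) •
      dJ (fun z => inChart F φ z ^ 2) z :=
  (hF.isLagrangian hφ).eq_of_jacobi_eq hE hz (pow_ne_zero 2 (hF.inChart_pos hφ hz).ne')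
    (hα.isotropic φ hφ z hz)

theorem hasConstantFlagCurvature_iff (hF : IsFinsler F) (hE : Module.finrank ℝ E = 2) :
    HasConstantFlagCurvature F ↔ ∃ c : ℝ, ∀ φ ∈ IsManifold.maximalAtlas 𝓘(ℝ, E) ∞ M,
      ∀ z ∈ slit φ, flagCurvature (fun z => inChart F φ z ^ 2) z = c := by
  refine exists_congr fun c => forall₄_congr fun φ hφ z hz => ?_
  exact (hF.isLagrangian hφ).jacobi_eq_iff hE hz (hF.inChart_pos hφ hz).ne'
    ((hF.contDiffAt_inChart hφ hz).differentiableAt (by simp)) c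

theorem weylOneVanishes_and_horizontallyClosed (hF : IsFinsler F)
    (hE : Module.finrank ℝ E = 2) {α : SemiBasic E M} (hα : IsIsotropicForm F α)
    (hc : HasConstantFlagCurvature F) : WeylOneVanishes F ∧ HorizontallyClosed F α := by
  have : FiniteDimensional ℝ E := Module.finite_of_finrank_pos (by omega)
  obtain ⟨c, hc⟩ := (hF.hasConstantFlagCurvature_iff hE).1 hc
  have hzero (φ) (hφ : φ ∈ IsManifold.maximalAtlas 𝓘(ℝ, E) ∞ M) (z) (hz : z ∈ slit φ) :
      fderiv ℝ (flagCurvature fun z => inChart F φ z ^ 2) z = 0 := by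
    have h1 : flagCurvature (fun z => inChart F φ z ^ 2) =ᶠ[𝓝 z] fun _ => c :=
      eventually_of_mem ((isOpen_slit φ).mem_nhds hz) (hc φ hφ)
    rw [h1.fderiv_eq, fderiv_fun_const]; rfl
  refine ⟨fun φ hφ z hz => ?_, fun φ hφ z hz ξ η => ?_⟩
  · refine ((hF.isLagrangian hφ).weylOne_eq_zero_iff hE hz
      (pow_ne_zero 2 (hF.inChart_pos hφ hz).ne')).2 fun u => ?_
    rw [hzero φ hφ z hz]; rfl
  · have h1 := (hF.isLagrangian hφ).dForm_horizontal_eq hz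
      (pow_ne_zero 2 (hF.inChart_pos hφ hz).ne') (fun z hz => hF.localForm_eq hE hα hφ hz) ξ η
    rw [hzero φ hφ z hz] at h1
    refine h1.trans ?_
    simp

theorem exists_eventually_tangentFlagCurvature_eq (hF : IsFinsler F)
    (hE : Module.finrank ℝ E = 2) {α : SemiBasic E M} (hα : IsIsotropicForm F α)
    (hW : WeylOneVanishes F) (hc : HorizontallyClosed F α) (x₀ : M) :
    ∃ c : ℝ, ∀ᶠ x in 𝓝 x₀, ∀ v : E, v ≠ 0 → tangentFlagCurvature F ⟨x, v⟩ = c := by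
  have : FiniteDimensional ℝ E := Module.finite_of_finrank_pos (by omega)
  have hφ := IsManifold.chart_mem_maximalAtlas (I := 𝓘(ℝ, E)) (n := ∞) x₀
  set φ := chartAt E x₀
  have hx₀ : x₀ ∈ φ.source := mem_chart_source E x₀
  -- A chart image need not be connected, so the local result is applied over a ball in it.
  obtain ⟨r, hr, hball⟩ := Metric.isOpen_iff.1 φ.open_target (φ x₀) (φ.map_source hx₀)
  have hsub : Metric.ball (φ x₀) r ×ˢ ({0}ᶜ : Set E) ⊆ slit φ := fun z hz => ⟨hball hz.1, hz.2⟩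
  obtain ⟨c, hκ⟩ := ((hF.isLagrangian hφ).mono
    (Metric.isOpen_ball.prod isOpen_compl_singleton) hsub).exists_flagCurvature_eq hE
    Metric.isOpen_ball (convex_ball _ _).isPreconnected
    (fun z hz => pow_ne_zero 2 (hF.inChart_pos hφ (hsub hz)).ne')
    (fun z hz => hW φ hφ z (hsub hz)) (fun z hz => hF.localForm_eq hE hα hφ (hsub hz))
    (fun z hz => hc φ hφ z (hsub hz))
  refine ⟨c, ?_⟩
  filter_upwards [φ.open_source.mem_nhds hx₀,
    (φ.continuousAt hx₀).preimage_mem_nhds (Metric.ball_mem_nhds _ hr)] with x hx hxr v hv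
  have hz := tangentCoord_mem_slit hφ (p := ⟨x, v⟩) hx hv
  rw [← lift_tangentCoord hφ (p := ⟨x, v⟩) hx, hF.tangentFlagCurvature_lift hE hφ hz]
  exact hκ _ ⟨hxr, hz.2⟩

theorem hasConstantFlagCurvature [PreconnectedSpace M] (hF : IsFinsler F)
    (hE : Module.finrank ℝ E = 2) {α : SemiBasic E M} (hα : IsIsotropicForm F α)
    (hW : WeylOneVanishes F) (hc : HorizontallyClosed F α) : HasConstantFlagCurvature F := by
  have : FiniteDimensional ℝ E := Module.finite_of_finrank_pos (by omega)
  have : Nontrivial E := Module.nontrivial_of_finrank_pos (R := ℝ) (by omega)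
  -- This one vector serves as a nonzero element of every tangent space. Continuity of `x ↦ (x, v₀)`
  -- is not needed: near each point `κ` takes one value on all nonzero vectors.
  obtain ⟨v₀, hv₀⟩ := exists_ne (0 : E)
  have hloc := hF.exists_eventually_tangentFlagCurvature_eq hE hα hW hc
  have hconst : IsLocallyConstant fun x : M => tangentFlagCurvature F ⟨x, v₀⟩ := by
    refine (IsLocallyConstant.iff_eventually_eq _).2 fun x₀ => ?_
    obtain ⟨c, hc⟩ := hloc x₀
    filter_upwards [hc] with x hx
    rw [hx v₀ hv₀, hc.self_of_nhds v₀ hv₀]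
  rcases isEmpty_or_nonempty M with hM | ⟨⟨x₁⟩⟩
  · exact ⟨0, fun φ hφ z hz => hM.elim (φ.symm z.1)⟩
  · refine (hF.hasConstantFlagCurvature_iff hE).2
      ⟨tangentFlagCurvature F ⟨x₁, v₀⟩, fun φ hφ z hz => ?_⟩
    obtain ⟨c, hc⟩ := hloc (lift φ z).1
    rw [← hF.tangentFlagCurvature_lift hE hφ hz,
      hconst.apply_eq_of_preconnectedSpace x₁ (lift φ z).1, hc.self_of_nhds v₀ hv₀]
    exact hc.self_of_nhds _ (lift_snd_ne_zero hφ hz)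

end IsFinsler

end FinslerFunction

end Finsler

end

theorem theorem3p2 {M : Type*} [TopologicalSpace M]
    [ChartedSpace (EuclideanSpace ℝ (Fin 2)) M] [IsManifold (𝓡 2) ∞ M] [ConnectedSpace M]
    (F : TangentBundle (𝓡 2) M → ℝ) (hF : Finsler.IsFinsler F) :
    (∃ α : Finsler.SemiBasic (EuclideanSpace ℝ (Fin 2)) M, Finsler.IsIsotropicForm F α) ∧
    ∀ α : Finsler.SemiBasic (EuclideanSpace ℝ (Fin 2)) M, Finsler.IsIsotropicForm F α →
      (Finsler.HasConstantFlagCurvature F ↔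
        Finsler.WeylOneVanishes F ∧ Finsler.HorizontallyClosed F α) := by
  have hE : Module.finrank ℝ (EuclideanSpace ℝ (Fin 2)) = 2 := finrank_euclideanSpace_fin
  exact ⟨⟨_, hF.isIsotropicForm_isotropicForm hE⟩, fun α hα =>
    ⟨hF.weylOneVanishes_and_horizontallyClosed hE hα,
      fun h => hF.hasConstantFlagCurvature hE hα h.1 h.2⟩⟩
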